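/- Let $n\ge 1$ be an integer, $\sigma>0$, $\eta>1$, $p>1$, $p'=\frac{p}{p-1}$, and $p_{\mathrm{crit}}(n,\sigma)=1+\frac{6\sigma}{\max\{3n-4\sigma,0\}}$ (equal to $\infty$ if $3n\le 4\sigma$). For $\epsilon>0$ consider the Cauchy problem $$u_{ttt}+(-\Delta)^{\sigma}u+\eta(-\Delta)^{\sigma/3}u_{tt}+\eta(-\Delta)^{2\sigma/3}u_t=|u|^p,\quad x\in\mathbb R^n,\ t>0,\qquad (u,u_t,u_{tt})(0,\cdot)=\epsilon(u_0,u_1,u_2),$$ where $(-\Delta)^{s}\phi=\mathcal F^{-1}(|\xi|^{2s}\mathcal F\phi)$ and all functions are real-valued. For $0<T<\infty$, a weak solution on $[0,T)$ is a function $u\in L^p_{\mathrm{loc}}([0,T)\times\mathbb R^n)$ which, unless $\sigma/3$ is an integer, also satisfies $\int_0^{T'}\!\int_{\mathbb R^n}|u|(1+|x|)^{-n-2\sigma/3}\,dx\,dt<\infty$ for all $T'<T$, and such that for every $\Phi\in C_0^\infty([0,T)\times\mathbb R^n)$ the right-hand integral below converges absolutely and $$\epsilon\int_{\mathbb R^n}\!\Big(u_2\Phi-u_1\Phi_t+u_0\Phi_{tt}+\eta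 u_1(-\Delta)^{\frac{\sigma}{3}}\Phi-\eta u_0(-\Delta)^{\frac{\sigma}{3}}\Phi_t+\eta u_0(-\Delta)^{\frac{2\sigma}{3}}\Phi\Big)\Big|_{t=0}dx+\int_0^T\!\!\int_{\mathbb R^n}|u|^p\Phi\,dx\,dt$$ $$=\int_0^T\!\!\int_{\mathbb R^n}u\,\Big(-\partial_t^3+(-\Delta)^{\sigma}+\eta(-\Delta)^{\frac{\sigma}{3}}\partial_t^2-\eta(-\Delta)^{\frac{2\sigma}{3}}\partial_t\Big)\Phi\,dx\,dt .$$ The lifespan $T_{\epsilon,\mathrm w}$ is the supremum of all $T>0$ for which there is a unique (up to almost everywhere equality) weak solution on $[0,T)$. Let $m>0$. (i) (Subcritical case.) If $p<p_{\mathrm{crit}}(n,\sigma)$, there is a constant $C>0$, depending only on $p,n,\sigma,\eta,m$, such that for all $u_0,u_1,u_2\in L^1(\mathbb R^n)$ with $\int u_2\,dx=m$ there is $\epsilon_0>0$ such that for every $\epsilon\in(0,\epsilon_0]$, every weak solution on an interval $[0,T)$ has $$T\le C\,\epsilon^{-\frac{2\sigma}{6\sigma p'-(3n+2\sigma)}},$$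 and the same bound holds for $T_{\epsilon,\mathrm w}$. (ii) (Critical case.) If $p=p_{\mathrm{crit}}(n,\sigma)$ and $\sigma\in 3\mathbb N$, there is a constant $C>0$, depending only on $p,n,\sigma,\eta,m$, such that for all $u_0,u_1,u_2\in C_0^\infty(\mathbb R^n)$ with $\int u_2\,dx=m$ there is $\epsilon_0>0$ such that for every $\epsilon\in(0,\epsilon_0]$, every weak solution on an interval $[0,T)$ has $$T\le \exp\big(C\epsilon^{-(p-1)}\big),$$ and the same bound holds for $T_{\epsilon,\mathrm w}$. -/

import Mathlib

open MeasureTheory Set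
open scoped ContDiff FourierTransform

/-- The critical exponent `1 + 6σ / (3n - 4σ)₊`, with value `∞` when `3n ≤ 4σ`.
(`ENNReal.ofReal` is the positive part, and in `ℝ≥0∞` a positive number divided by `0` is `∞`.) -/
noncomputable def pCrit (n : ℕ) (σ : ℝ) : ENNReal :=
  1 + ENNReal.ofReal (6 * σ) / ENNReal.ofReal (3 * n - 4 * σ)

/-- The fractional Laplacian `(-Δ)^s φ = F⁻¹(|ξ|^{2s} F φ)` of a real function on `ℝⁿ`.
Mathlib's Fourier transform has the kernel `exp(-2πi x·ξ)`, so the symbol is `(2π|ξ|)^{2s}`.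
The inverse transform of this conjugate-symmetric function is real; `re` only changes its type. -/
noncomputable def fracLaplacian {n : ℕ} (s : ℝ) (φ : EuclideanSpace ℝ (Fin n) → ℝ) :
    EuclideanSpace ℝ (Fin n) → ℝ := fun x =>
  (𝓕⁻ (fun ξ : EuclideanSpace ℝ (Fin n) =>
    (((2 * Real.pi * ‖ξ‖) ^ (2 * s) : ℝ) : ℂ) *
      𝓕 (fun y : EuclideanSpace ℝ (Fin n) => ((φ y : ℝ) : ℂ)) ξ) x).re

/-- The `k`-th time derivative of `Φ(t, x)`. -/
noncomputable def timeDeriv {n : ℕ} (k : ℕ) (Φ : ℝ × EuclideanSpace ℝ (Fin n) → ℝ) (t : ℝ)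
    (x : EuclideanSpace ℝ (Fin n)) : ℝ :=
  iteratedDeriv k (fun s => Φ (s, x)) t

/-- The test functions: `C₀^∞([0,T) × ℝⁿ)`, each given as a smooth function on `ℝ × ℝⁿ`
with compact support contained in `(-∞,T) × ℝⁿ`. -/
structure IsTestFunction {n : ℕ} (T : ℝ) (Φ : ℝ × EuclideanSpace ℝ (Fin n) → ℝ) : Prop where
  smooth : ContDiff ℝ ∞ Φ
  compact : HasCompactSupport Φ
  support : tsupport Φ ⊆ Iio T ×ˢ univ

/-- The adjoint operator
`-∂ₜ³Φ + (-Δ)^σ Φ + η (-Δ)^{σ/3} ∂ₜ²Φ - η (-Δ)^{2σ/3} ∂ₜΦ`. -/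
noncomputable def adjointOp {n : ℕ} (σ η : ℝ) (Φ : ℝ × EuclideanSpace ℝ (Fin n) → ℝ)
    (z : ℝ × EuclideanSpace ℝ (Fin n)) : ℝ :=
  - timeDeriv 3 Φ z.1 z.2
    + fracLaplacian σ (timeDeriv 0 Φ z.1) z.2
    + η * fracLaplacian (σ / 3) (timeDeriv 2 Φ z.1) z.2
    - η * fracLaplacian (2 * σ / 3) (timeDeriv 1 Φ z.1) z.2

/-- The density of the initial-data term in the weak formulation: the boundary terms at `t = 0`
left by moving all the derivatives of the equation onto `Φ`.
If `Φ = φ(x) ζ(t)` with `ζ = 1` near `0`, it is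
`η u₀ (-Δ)^{2σ/3} φ + η u₁ (-Δ)^{σ/3} φ + u₂ φ`. -/
noncomputable def dataTerm {n : ℕ} (σ η : ℝ) (u₀ u₁ u₂ : EuclideanSpace ℝ (Fin n) → ℝ)
    (Φ : ℝ × EuclideanSpace ℝ (Fin n) → ℝ) (x : EuclideanSpace ℝ (Fin n)) : ℝ :=
  u₂ x * timeDeriv 0 Φ 0 x - u₁ x * timeDeriv 1 Φ 0 x + u₀ x * timeDeriv 2 Φ 0 x
    + η * (u₁ x * fracLaplacian (σ / 3) (timeDeriv 0 Φ 0) x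
      - u₀ x * fracLaplacian (σ / 3) (timeDeriv 1 Φ 0) x)
    + η * (u₀ x * fracLaplacian (2 * σ / 3) (timeDeriv 0 Φ 0) x)

/-- `u` is a weak solution on `[0,T)` of
`u_ttt + (-Δ)^σ u + η (-Δ)^{σ/3} u_tt + η (-Δ)^{2σ/3} u_t = |u|^p`,
`(u, u_t, u_tt)(0) = ε (u₀, u₁, u₂)`. -/
structure IsWeakSolution {n : ℕ} (σ η p ε : ℝ) (u₀ u₁ u₂ : EuclideanSpace ℝ (Fin n) → ℝ)
    (T : ℝ) (u : ℝ × EuclideanSpace ℝ (Fin n) → ℝ) : Prop where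
  pos : 0 < T
  measurable : AEStronglyMeasurable u (volume.restrict (Ioo 0 T ×ˢ univ))
  /-- `u` is in `L^p_loc([0,T) × ℝⁿ)`. -/
  locally_integrable : ∀ T' < T, ∀ r : ℝ,
    IntegrableOn (fun z => |u z| ^ p) (Ioo 0 T' ×ˢ Metric.ball 0 r)
  /-- The usual tail condition for a nonlocal operator. For a test function `φ`,
  `(-Δ)^{σ/3} φ` decays like `|x|^{-n-2σ/3}`, unless `σ/3` is an integer,
  in which case the equation is local and no condition at infinity is needed. -/
  tail_integrable : (¬ ∃ k : ℕ, σ = 3 * k) → ∀ T' < T,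
    IntegrableOn (fun z => |u z| * (1 + ‖z.2‖) ^ (-((n : ℝ) + 2 * σ / 3))) (Ioo 0 T' ×ˢ univ)
  /-- The integral against the adjoint operator is well defined. -/
  adjoint_integrable : ∀ Φ, IsTestFunction T Φ →
    IntegrableOn (fun z => u z * adjointOp σ η Φ z) (Ioo 0 T ×ˢ univ)
  /-- The weak form of the equation. -/
  weak_eq : ∀ Φ, IsTestFunction T Φ →
    ε * (∫ x, dataTerm σ η u₀ u₁ u₂ Φ x) + ∫ z in Ioo 0 T ×ˢ univ, |u z| ^ p * Φ z
      = ∫ z in Ioo 0 T ×ˢ univ, u z * adjointOp σ η Φ z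

/-- The lifespan of weak solutions: the supremum of the `T > 0` for which there is a unique
weak solution on `[0,T)` (unique up to equality almost everywhere). -/
noncomputable def weakLifespan {n : ℕ} (σ η p ε : ℝ)
    (u₀ u₁ u₂ : EuclideanSpace ℝ (Fin n) → ℝ) : ENNReal :=
  sSup {τ | ∃ T : ℝ, τ = ENNReal.ofReal T ∧
    ∃ u, IsWeakSolution σ η p ε u₀ u₁ u₂ T u ∧
      ∀ v, IsWeakSolution σ η p ε u₀ u₁ u₂ T v →
        v =ᵐ[volume.restrict (Ioo 0 T ×ˢ univ)] u}

/-!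
The bounds come from the test function method. Let `u` be a weak solution on `[0,T)` and `S < T`,
and test with `Φ(t,x) = ζ(t/S) φ(x/R)`, where `R = S^{3/(2σ)}` makes all terms of the adjoint
operator scale like `S⁻³`. If `|(-Δ)^s φ| ≤ A φ^{1/p} w^{1-1/p}` for `s = σ/3, 2σ/3, σ` with an
integrable `w`, Hölder's inequality bounds `∫ u · (adjoint operator) Φ` by
`M (∫ |u|^p Φ)^{1/p}` with `M` a constant times `S^{-e}`, and `e > 0` (`e = 0`) exactly in the
subcritical (critical) case (`IsWeakSolution.test_inequality`, `scale_identity`). The data term is at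
least `ε m / 2` once `S` exceeds a threshold that depends on the data only
(`exists_half_le_integral_dataTerm`).

* In the subcritical case Young's inequality absorbs `∫ |u|^p Φ` and leaves `ε m ≲ S^{-e p'}`
  (`lifespan_le_of_profiles`).
* In the critical case the adjoint operator acts only on an annulus of scale `S`, disjoint from the
  support of the test function of scale `S/2`. With `a_j = ∫ |u|^p Φ` at the scale `2^j S₀` this
  gives `(ε m / 2 + a_{j+1})^p ≲ a_{j+1} - a_j`, a discrete form of `y' = y^p`, which allows only
  `O(ε^{-(p-1)})` scales (`length_le_of_pow_le_increment`, `critical_lifespan_le`).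

The profile `φ` depends on whether `σ/3` is an integer. If it is, the operators are local, and a high
power of a bump function works, since each derivative removes only one factor
(`exists_local_profile`). If it is not, no compactly supported `φ` satisfies the pointwise bound,
because `(-Δ)^{σ/3} φ` has a tail of size `|x|^{-b}`, `b = n + 2σ/3`. Then `φ` is a partial sum of
`∑_j 2^{-jb} ψ(x/2^j)` with a bump `ψ`. These sums are test functions comparable to `(1+|x|)^{-b}` on
larger and larger balls, and by homogeneity their fractional Laplacians are `O((1+|x|)^{-b})`
uniformly (`exists_nonlocal_profiles`). The part of the integral outside the ball tends to zero by the
tail condition on `u`.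

What remains is the decay `(-Δ)^s ψ = O(|x|^{-n-2s})` (`exists_decay_fracLaplacian`). Away from
`ξ = 0` the symbol is a smooth multiplier and contributes a Schwartz function. The low-frequency part
has the kernel `E = 𝓕⁻¹(|ξ|^{2s} χ)`, and homogeneity of `|ξ|^{2s}` makes `E(x) - 2^{-n-2s} E(x/2)`
a Schwartz function, which forces the decay of `E` (`decay_of_dyadic_recursion`).
-/

open Filter Topology
open scoped SchwartzMap Laplacian LineDeriv

/-! ### The fractional Laplacian of test functions -/

/-- The Fourier symbol `(2π|ξ|)^{2s}` of `(-Δ)^s`. -/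
noncomputable def fracSymbol {n : ℕ} (s : ℝ) (ξ : EuclideanSpace ℝ (Fin n)) : ℂ :=
  (((2 * Real.pi * ‖ξ‖) ^ (2 * s) : ℝ) : ℂ)

lemma fracLaplacian_eq {n : ℕ} (s : ℝ) (φ : EuclideanSpace ℝ (Fin n) → ℝ)
    (x : EuclideanSpace ℝ (Fin n)) :
    fracLaplacian s φ x =
      (𝓕⁻ (fun ξ => fracSymbol s ξ * 𝓕 (fun y => ((φ y : ℝ) : ℂ)) ξ) x).re := rfl

lemma continuous_fracSymbol {n : ℕ} {s : ℝ} (hs : 0 ≤ s) :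
    Continuous (fracSymbol s : EuclideanSpace ℝ (Fin n) → ℂ) := by
  unfold fracSymbol
  refine Complex.continuous_ofReal.comp (Continuous.rpow_const (by fun_prop) fun x => Or.inr ?_)
  positivity

lemma fourier_comp_inv_smul {n : ℕ} (f : EuclideanSpace ℝ (Fin n) → ℂ) {R : ℝ} (hR : 0 < R)
    (ξ : EuclideanSpace ℝ (Fin n)) :
    𝓕 (fun x => f (R⁻¹ • x)) ξ = ((R ^ n : ℝ) : ℂ) * 𝓕 f (R • ξ) := by
  rw [Real.fourier_eq, Real.fourier_eq]
  have h := Measure.integral_comp_inv_smul (μ := (volume : Measure (EuclideanSpace ℝ (Fin n))))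
    (fun v => Real.fourierChar (-inner ℝ v (R • ξ)) • f v) R
  rw [finrank_euclideanSpace, Fintype.card_fin, abs_of_pos (by positivity)] at h
  rw [← Complex.real_smul, ← h]
  refine integral_congr_ae (Filter.Eventually.of_forall fun v => ?_)
  simp only [inner_smul_left, inner_smul_right]
  simp only [map_inv₀, conj_trivial]
  rw [← mul_assoc, mul_inv_cancel₀ hR.ne', one_mul]

lemma fourierInv_comp_smul {n : ℕ} (f : EuclideanSpace ℝ (Fin n) → ℂ) {R : ℝ} (hR : 0 < R)
    (x : EuclideanSpace ℝ (Fin n)) :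
    𝓕⁻ (fun ξ => f (R • ξ)) x = (((R ^ n)⁻¹ : ℝ) : ℂ) * 𝓕⁻ f (R⁻¹ • x) := by
  rw [Real.fourierInv_eq_fourier_neg, Real.fourierInv_eq_fourier_neg]
  have h := fourier_comp_inv_smul f (inv_pos.2 hR) (-x)
  rw [inv_inv] at h
  rw [h, inv_pow, smul_neg]

/-- Homogeneity of the fractional Laplacian under dilations. -/
lemma fracLaplacian_const_mul_comp_inv_smul {n : ℕ} (s c : ℝ) (φ : EuclideanSpace ℝ (Fin n) → ℝ)
    {R : ℝ} (hR : 0 < R) (x : EuclideanSpace ℝ (Fin n)) :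
    fracLaplacian s (fun y => c * φ (R⁻¹ • y)) x
      = c * (R ^ (-(2 * s)) * fracLaplacian s φ (R⁻¹ • x)) := by
  rw [fracLaplacian_eq, fracLaplacian_eq]
  set g : EuclideanSpace ℝ (Fin n) → ℂ :=
    fun ξ => fracSymbol s ξ * 𝓕 (fun y => ((φ y : ℝ) : ℂ)) ξ with hg
  have h1 : (fun ξ : EuclideanSpace ℝ (Fin n) =>
      fracSymbol s ξ * 𝓕 (fun y => (((c * φ (R⁻¹ • y) : ℝ)) : ℂ)) ξ)
      = (((c * R ^ (-(2 * s)) * R ^ n : ℝ)) : ℂ) • fun ξ => g (R • ξ) := by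
    funext ξ
    have h2 : 𝓕 (fun y : EuclideanSpace ℝ (Fin n) => (((c * φ (R⁻¹ • y) : ℝ)) : ℂ)) ξ
        = (c : ℂ) * 𝓕 (fun y => ((φ (R⁻¹ • y) : ℝ) : ℂ)) ξ := by
      rw [Real.fourier_eq, Real.fourier_eq, ← integral_const_mul]
      refine integral_congr_ae (Filter.Eventually.of_forall fun v => ?_)
      simp only [Circle.smul_def, smul_eq_mul]
      push_cast
      ring
    have h3 : fracSymbol s (R • ξ) = ((R ^ (2 * s) : ℝ) : ℂ) * fracSymbol s ξ := by
      simp only [fracSymbol]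
      rw [norm_smul, Real.norm_eq_abs, abs_of_pos hR,
        show 2 * Real.pi * (R * ‖ξ‖) = R * (2 * Real.pi * ‖ξ‖) by ring,
        Real.mul_rpow hR.le (by positivity)]
      push_cast
      rfl
    rw [h2, fourier_comp_inv_smul (fun y => ((φ y : ℝ) : ℂ)) hR ξ]
    simp only [Pi.smul_apply, hg, smul_eq_mul, h3]
    have h4 : ((R ^ (-(2 * s)) : ℝ) : ℂ) * ((R ^ (2 * s) : ℝ) : ℂ) = 1 := by
      rw [← Complex.ofReal_mul, ← Real.rpow_add hR]
      simp
    push_cast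
    linear_combination (-(c : ℂ) * R ^ n * fracSymbol s ξ *
      𝓕 (fun y => ((φ y : ℝ) : ℂ)) (R • ξ)) * h4
  rw [h1]
  have h5 : 𝓕⁻ ((((c * R ^ (-(2 * s)) * R ^ n : ℝ)) : ℂ) • fun ξ => g (R • ξ)) x
      = (((c * R ^ (-(2 * s)) * R ^ n : ℝ)) : ℂ) * 𝓕⁻ (fun ξ => g (R • ξ)) x := by
    rw [Real.fourierInv_eq, Real.fourierInv_eq, ← integral_const_mul]
    refine integral_congr_ae (Filter.Eventually.of_forall fun v => ?_)
    simp only [Circle.smul_def, smul_eq_mul, Pi.smul_apply]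
    ring
  rw [h5, fourierInv_comp_smul g hR, ← mul_assoc, ← Complex.ofReal_mul, Complex.re_ofReal_mul]
  have : (R ^ n : ℝ) ≠ 0 := by positivity
  field_simp

lemma integrable_fracSymbol_mul {n : ℕ} {s : ℝ} (hs : 0 ≤ s)
    (f : 𝓢(EuclideanSpace ℝ (Fin n), ℂ)) : Integrable (fun ξ => fracSymbol s ξ * f ξ) := by
  have hg : (fun ξ : EuclideanSpace ℝ (Fin n) => (1 + ‖ξ‖ ^ 2) ^ s).HasTemperateGrowth := by
    fun_prop
  have h := (SchwartzMap.smulLeftCLM ℂ (fun ξ : EuclideanSpace ℝ (Fin n) =>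
    (1 + ‖ξ‖ ^ 2) ^ s) f).integrable (μ := volume)
  refine (h.norm.const_mul ((2 * Real.pi) ^ (2 * s))).mono'
    ((continuous_fracSymbol hs).mul f.continuous).aestronglyMeasurable
    (Filter.Eventually.of_forall fun ξ => ?_)
  rw [SchwartzMap.smulLeftCLM_apply_apply hg, norm_smul, norm_mul, ← mul_assoc]
  refine mul_le_mul_of_nonneg_right ?_ (norm_nonneg _)
  rw [fracSymbol, Complex.norm_real, Real.norm_of_nonneg (by positivity),
    Real.norm_of_nonneg (by positivity), Real.mul_rpow (by positivity) (by positivity)]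
  refine mul_le_mul_of_nonneg_left ?_ (by positivity)
  rw [Real.rpow_mul (norm_nonneg _)]
  refine Real.rpow_le_rpow (by positivity) ?_ hs
  rw [Real.rpow_two]
  linarith

/-- A real test function as a complex Schwartz function. -/
noncomputable def schwartzOfReal {n : ℕ} {φ : EuclideanSpace ℝ (Fin n) → ℝ} (hφ : ContDiff ℝ ∞ φ)
    (hc : HasCompactSupport φ) : 𝓢(EuclideanSpace ℝ (Fin n), ℂ) :=
  HasCompactSupport.toSchwartzMap (f := fun x => ((φ x : ℝ) : ℂ))
    (hc.comp_left (g := Complex.ofReal) Complex.ofReal_zero) (Complex.ofRealCLM.contDiff.comp hφ)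

lemma integrable_fracSymbol_mul_fourier {n : ℕ} {s : ℝ} (hs : 0 ≤ s)
    {φ : EuclideanSpace ℝ (Fin n) → ℝ} (hφ : ContDiff ℝ ∞ φ) (hc : HasCompactSupport φ) :
    Integrable (fun ξ => fracSymbol s ξ * 𝓕 (fun y => ((φ y : ℝ) : ℂ)) ξ) := by
  have := integrable_fracSymbol_mul hs (𝓕 (schwartzOfReal hφ hc))
  rw [SchwartzMap.fourier_coe] at this
  exact this

lemma continuous_fourierInv {n : ℕ} {f : EuclideanSpace ℝ (Fin n) → ℂ} (hf : Integrable f) :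
    Continuous (𝓕⁻ f) := by
  rw [Real.fourierInv_eq_fourier_comp_neg]
  exact VectorFourier.fourierIntegral_continuous Real.continuous_fourierChar
    (by exact continuous_inner) hf.comp_neg

lemma continuous_fracLaplacian {n : ℕ} {s : ℝ} (hs : 0 ≤ s)
    {φ : EuclideanSpace ℝ (Fin n) → ℝ} (hφ : ContDiff ℝ ∞ φ) (hc : HasCompactSupport φ) :
    Continuous (fracLaplacian s φ) :=
  Complex.continuous_re.comp (continuous_fourierInv (integrable_fracSymbol_mul_fourier hs hφ hc))

lemma fourierInv_fun_add {n : ℕ} {f g : EuclideanSpace ℝ (Fin n) → ℂ} (hf : Integrable f)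
    (hg : Integrable g) (x : EuclideanSpace ℝ (Fin n)) :
    𝓕⁻ (fun ξ => f ξ + g ξ) x = 𝓕⁻ f x + 𝓕⁻ g x := by
  rw [Real.fourierInv_eq_fourier_neg, Real.fourierInv_eq_fourier_neg,
    Real.fourierInv_eq_fourier_neg]
  exact congrFun (VectorFourier.fourierIntegral_add Real.continuous_fourierChar
    (by exact continuous_inner) hf hg) (-x)

lemma fourier_fun_add {n : ℕ} {f g : EuclideanSpace ℝ (Fin n) → ℂ} (hf : Integrable f)
    (hg : Integrable g) (x : EuclideanSpace ℝ (Fin n)) :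
    𝓕 (fun ξ => f ξ + g ξ) x = 𝓕 f x + 𝓕 g x :=
  congrFun (VectorFourier.fourierIntegral_add Real.continuous_fourierChar
    (by exact continuous_inner) hf hg) x

lemma fracLaplacian_add {n : ℕ} {s : ℝ} (hs : 0 ≤ s)
    {φ ψ : EuclideanSpace ℝ (Fin n) → ℝ} (hφ : ContDiff ℝ ∞ φ) (hc : HasCompactSupport φ)
    (hψ : ContDiff ℝ ∞ ψ) (hd : HasCompactSupport ψ) (x : EuclideanSpace ℝ (Fin n)) :
    fracLaplacian s (fun y => φ y + ψ y) x = fracLaplacian s φ x + fracLaplacian s ψ x := by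
  rw [fracLaplacian_eq, fracLaplacian_eq, fracLaplacian_eq, ← Complex.add_re,
    ← fourierInv_fun_add (integrable_fracSymbol_mul_fourier hs hφ hc)
      (integrable_fracSymbol_mul_fourier hs hψ hd)]
  congr 1
  refine congrFun (congrArg _ (funext fun ξ => ?_)) x
  have h : 𝓕 (fun y => ((φ y : ℝ) : ℂ) + ((ψ y : ℝ) : ℂ)) ξ
      = 𝓕 (fun y => ((φ y : ℝ) : ℂ)) ξ + 𝓕 (fun y => ((ψ y : ℝ) : ℂ)) ξ :=
    fourier_fun_add (schwartzOfReal hφ hc).integrable (schwartzOfReal hψ hd).integrable ξ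
  rw [← mul_add, ← h]
  congr 1
  refine congrFun (congrArg _ (funext fun y => ?_)) ξ
  exact Complex.ofReal_add _ _

/-! ### Decay of the fractional Laplacian of a test function -/

/-- Schwartz functions decay faster than any power. -/
lemma SchwartzMap.exists_norm_le_one_add_norm_rpow {n : ℕ}
    (f : 𝓢(EuclideanSpace ℝ (Fin n), ℂ)) (a : ℝ) :
    ∃ C > 0, ∀ x, ‖f x‖ ≤ C * (1 + ‖x‖) ^ (-a) := by
  obtain ⟨k, hk⟩ := exists_nat_ge a
  set C := 2 ^ k * (((Finset.Iic (k, 0)).sup fun m => SchwartzMap.seminorm ℝ m.1 m.2) f)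
  have h : ∀ x, (1 + ‖x‖) ^ k * ‖f x‖ ≤ C := fun x => by
    have := SchwartzMap.one_add_le_sup_seminorm_apply (𝕜 := ℝ) (m := (k, 0)) (k := k) (n := 0)
      le_rfl le_rfl f x
    rwa [norm_iteratedFDeriv_zero] at this
  refine ⟨|C| + 1, by positivity, fun x => ?_⟩
  have hx : (1 : ℝ) ≤ 1 + ‖x‖ := by linarith [norm_nonneg x]
  have h0 : (0 : ℝ) < 1 + ‖x‖ := by linarith
  have h1 : (1 + ‖x‖) ^ a ≤ (1 + ‖x‖) ^ k := by
    rw [← Real.rpow_natCast]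
    exact Real.rpow_le_rpow_of_exponent_le hx hk
  rw [Real.rpow_neg h0.le, ← div_eq_mul_inv, le_div_iff₀ (by positivity), mul_comm]
  calc (1 + ‖x‖) ^ a * ‖f x‖ ≤ (1 + ‖x‖) ^ k * ‖f x‖ := by gcongr
    _ ≤ C := h x
    _ ≤ |C| + 1 := by linarith [le_abs_self C]

/-- A smooth radial cutoff in frequency, equal to `1` for `|ξ|` small and to `0` for `|ξ|` large,
and the accompanying factorization of the remaining high-frequency part of `|ξ|^{2s}`. -/
lemma exists_frequency_cutoff (n : ℕ) (s : ℝ) :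
    ∃ χ : EuclideanSpace ℝ (Fin n) → ℝ, ContDiff ℝ ∞ χ ∧ HasCompactSupport χ ∧
      (∀ ξ, ‖ξ‖ < 1 → χ ξ = 1) ∧
      (fun ξ => ‖ξ‖ ^ (2 * s) * (1 - χ ξ)).HasTemperateGrowth := by
  let θ : ContDiffBump (0 : ℝ) := ⟨1 / 4, 1 / 2, by norm_num, by norm_num⟩
  let v : EuclideanSpace ℝ (Fin n) → ℝ := fun ξ => (1 + ‖ξ‖ ^ 2) ^ (-1 : ℝ)
  have hv : v.HasTemperateGrowth := by fun_prop
  have hveq : ∀ ξ, v ξ = (1 + ‖ξ‖ ^ 2)⁻¹ := fun ξ => Real.rpow_neg_one _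
  have hθs : ContDiff ℝ ∞ θ := θ.contDiff
  let G : ℝ → ℝ := fun r => (1 - r) ^ s * θ r
  have hG : G.HasTemperateGrowth := by
    refine HasCompactSupport.hasTemperateGrowth (θ.hasCompactSupport.mul_left) ?_
    refine contDiff_iff_contDiffAt.2 fun r => ?_
    rcases lt_or_ge r 1 with hr | hr
    · exact (ContDiffAt.rpow_const_of_ne (by fun_prop) (by linarith)).mul hθs.contDiffAt
    · have : G =ᶠ[nhds r] fun _ => 0 := by
        filter_upwards [lt_mem_nhds (show (1 / 2 : ℝ) < r by linarith)] with y hy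
        have : θ y = 0 := θ.zero_of_le_dist (by
          rw [Real.dist_eq, sub_zero]; exact hy.le.trans (le_abs_self y))
        simp [G, this]
      exact contDiffAt_const.congr_of_eventuallyEq this
  refine ⟨fun ξ => 1 - θ (v ξ), contDiff_const.sub (hθs.comp hv.1), ?_, ?_, ?_⟩
  · refine HasCompactSupport.of_support_subset_isCompact
      (isCompact_closedBall (0 : EuclideanSpace ℝ (Fin n)) 2) fun ξ hξ => ?_
    by_contra h
    rw [mem_closedBall_zero_iff, not_le] at h
    refine hξ ?_
    have : θ (v ξ) = 1 := θ.one_of_mem_closedBall (by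
      rw [mem_closedBall_zero_iff, hveq, Real.norm_of_nonneg (by positivity)]
      change _ ≤ (1 / 4 : ℝ)
      rw [one_div]
      gcongr
      nlinarith)
    simp [this]
  · intro ξ hξ
    have : θ (v ξ) = 0 := θ.zero_of_le_dist (by
      rw [dist_zero_right, hveq, Real.norm_of_nonneg (by positivity)]
      change (1 / 2 : ℝ) ≤ _
      rw [one_div]
      gcongr
      nlinarith [norm_nonneg ξ])
    simp [this]
  · have h1 : (fun ξ : EuclideanSpace ℝ (Fin n) =>
        (1 + ‖ξ‖ ^ 2) ^ s * (G ∘ v) ξ).HasTemperateGrowth := by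
      have := hG.comp hv
      fun_prop
    convert h1 using 2 with ξ
    simp only [Function.comp, G, hveq, sub_sub_cancel]
    rw [← mul_assoc, ← Real.mul_rpow (by positivity)
      (sub_nonneg.2 (inv_le_one_of_one_le₀ (by nlinarith [norm_nonneg ξ]))),
      mul_sub, mul_inv_cancel₀ (by positivity), Real.rpow_mul (norm_nonneg _), Real.rpow_two]
    congr 2
    ring

/-- If `|E|` is bounded and `E(x) - 2^{-a} E(x/2)` decays like `|x|^{-a-1}`,
then `E` decays like `|x|^{-a}`. -/
lemma decay_of_dyadic_recursion {n : ℕ} {E : EuclideanSpace ℝ (Fin n) → ℂ} {a M C : ℝ}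
    (ha : 0 < a) (hM : ∀ x, ‖E x‖ ≤ M)
    (hC : ∀ x, ‖E x - (2 ^ (-a) : ℝ) * E ((2 : ℝ)⁻¹ • x)‖ ≤ C * (1 + ‖x‖) ^ (-(a + 1)))
    (hC0 : 0 < C) :
    ∃ D > 0, ∀ x, ‖E x‖ ≤ D * (1 + ‖x‖) ^ (-a) := by
  have hM0 : 0 ≤ M := (norm_nonneg _).trans (hM 0)
  -- the correction `3C/(1+|x|)` makes the bound stable under the recursion
  have key : ∀ k : ℕ, ∀ x : EuclideanSpace ℝ (Fin n), ‖x‖ ≤ 2 ^ k →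
      ‖x‖ ^ a * ‖E x‖ ≤ M + 3 * C - 3 * C / (1 + ‖x‖) := by
    have base : ∀ x : EuclideanSpace ℝ (Fin n), ‖x‖ ≤ 1 →
        ‖x‖ ^ a * ‖E x‖ ≤ M + 3 * C - 3 * C / (1 + ‖x‖) := fun x hx => by
      have h1 : ‖x‖ ^ a ≤ 1 := Real.rpow_le_one (norm_nonneg _) hx ha.le
      have h2 : 3 * C / (1 + ‖x‖) ≤ 3 * C :=
        div_le_self (by positivity) (by linarith [norm_nonneg x])
      have h3 : ‖x‖ ^ a * ‖E x‖ ≤ 1 * M := by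
        gcongr
        exact hM x
      linarith
    intro k
    induction k with
    | zero => intro x hx; exact base x (by simpa using hx)
    | succ k ih =>
      intro x hx
      rcases le_total ‖x‖ 1 with h1 | h1
      · exact base x h1
      have hn : ‖(2 : ℝ)⁻¹ • x‖ = ‖x‖ / 2 := by
        rw [norm_smul, norm_inv, Real.norm_ofNat]; ring
      have h2 := ih ((2 : ℝ)⁻¹ • x) (by rw [hn]; rw [pow_succ] at hx; linarith)
      rw [hn] at h2
      have hx0 : 0 < ‖x‖ := by linarith
      have h3 : ‖E x‖ ≤ 2 ^ (-a) * ‖E ((2 : ℝ)⁻¹ • x)‖ + C * (1 + ‖x‖) ^ (-(a + 1)) := by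
        have := norm_le_norm_add_norm_sub' (E x) ((2 ^ (-a) : ℝ) * E ((2 : ℝ)⁻¹ • x))
        rw [norm_mul, Complex.norm_real, Real.norm_of_nonneg (by positivity)] at this
        linarith [hC x]
      have h4 : ‖x‖ ^ a * 2 ^ (-a) = (‖x‖ / 2) ^ a := by
        rw [Real.div_rpow hx0.le (by norm_num), Real.rpow_neg (by norm_num)]; rfl
      have h5 : ‖x‖ ^ a * (1 + ‖x‖) ^ (-(a + 1)) ≤ 1 / (1 + ‖x‖) := by
        rw [neg_add, Real.rpow_add (by positivity), Real.rpow_neg_one, ← mul_assoc, one_div]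
        refine mul_le_of_le_one_left (by positivity) ?_
        rw [Real.rpow_neg (by positivity), ← div_eq_mul_inv, div_le_one (by positivity)]
        exact Real.rpow_le_rpow hx0.le (by linarith) ha.le
      have h6 : 3 * C / (1 + ‖x‖) + C * (1 / (1 + ‖x‖)) ≤ 3 * C / (1 + ‖x‖ / 2) := by
        rw [mul_one_div, ← add_div, div_le_div_iff₀ (by positivity) (by positivity)]
        nlinarith
      calc ‖x‖ ^ a * ‖E x‖
          ≤ ‖x‖ ^ a * (2 ^ (-a) * ‖E ((2 : ℝ)⁻¹ • x)‖ + C * (1 + ‖x‖) ^ (-(a + 1))) := by gcongr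
        _ = (‖x‖ / 2) ^ a * ‖E ((2 : ℝ)⁻¹ • x)‖ + C * (‖x‖ ^ a * (1 + ‖x‖) ^ (-(a + 1))) := by
            rw [← h4]; ring
        _ ≤ (M + 3 * C - 3 * C / (1 + ‖x‖ / 2)) + C * (1 / (1 + ‖x‖)) := by gcongr
        _ ≤ _ := by linarith
  refine ⟨2 ^ a * (M + 3 * C), by positivity, fun x => ?_⟩
  rw [Real.rpow_neg (by positivity), ← div_eq_mul_inv, le_div_iff₀ (by positivity), mul_comm]
  rcases le_total ‖x‖ 1 with h1 | h1
  · have : (1 + ‖x‖) ^ a ≤ 2 ^ a := Real.rpow_le_rpow (by positivity) (by linarith) ha.le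
    calc (1 + ‖x‖) ^ a * ‖E x‖ ≤ 2 ^ a * M := by gcongr; exact hM x
      _ ≤ _ := by gcongr; linarith
  · obtain ⟨k, hk⟩ := pow_unbounded_of_one_lt ‖x‖ (one_lt_two (α := ℝ))
    have h2 := key k x hk.le
    have h3 : (1 + ‖x‖) ^ a ≤ 2 ^ a * ‖x‖ ^ a := by
      rw [← Real.mul_rpow (by norm_num) (by positivity)]
      exact Real.rpow_le_rpow (by positivity) (by linarith) ha.le
    have h4 : 0 ≤ 3 * C / (1 + ‖x‖) := by positivity
    calc (1 + ‖x‖) ^ a * ‖E x‖ ≤ 2 ^ a * ‖x‖ ^ a * ‖E x‖ := by gcongr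
      _ = 2 ^ a * (‖x‖ ^ a * ‖E x‖) := by ring
      _ ≤ _ := by gcongr; linarith

lemma fourierInv_mul_fourier_eq_integral {n : ℕ} {L f : EuclideanSpace ℝ (Fin n) → ℂ}
    (hL : Integrable L) (hf : Integrable f) (x : EuclideanSpace ℝ (Fin n)) :
    𝓕⁻ (fun ξ => L ξ * 𝓕 f ξ) x = ∫ y, f y * 𝓕⁻ L (x - y) := by
  have hg : Integrable (fun ξ => Real.fourierChar (inner ℝ ξ x) • L ξ) := by
    have := (Real.fourierIntegral_convergent_iff (μ := volume) (f := L) (-x)).2 hL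
    simpa using this
  have h := VectorFourier.integral_fourierIntegral_smul_eq_flip (μ := volume) (ν := volume)
    (L := innerₗ (EuclideanSpace ℝ (Fin n))) Real.continuous_fourierChar
    (by exact continuous_inner) hf hg
  rw [Real.fourierInv_eq]
  calc ∫ ξ, Real.fourierChar (inner ℝ ξ x) • (L ξ * 𝓕 f ξ)
      = ∫ ξ, 𝓕 f ξ • (Real.fourierChar (inner ℝ ξ x) • L ξ) := by
        refine integral_congr_ae (Filter.Eventually.of_forall fun ξ => ?_)
        simp only [Circle.smul_def, smul_eq_mul]
        ring
    _ = _ := h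
    _ = _ := by
        refine integral_congr_ae (Filter.Eventually.of_forall fun y => ?_)
        simp only [smul_eq_mul]
        congr 1
        rw [Real.fourierInv_eq]
        refine integral_congr_ae (Filter.Eventually.of_forall fun ξ => ?_)
        simp only [smul_smul, ← AddChar.map_add_eq_mul]
        congr 2
        simp [inner_sub_right]
        ring

/-- The inverse Fourier transform of `|ξ|^{2s} χ(ξ)`, with `χ` a cutoff equal to `1` near `0`,
decays like `|x|^{-n-2s}`: the homogeneity of `|ξ|^{2s}` makes the difference with its own dilate
by `2` the transform of a test function. -/
lemma exists_decay_fourierInv_low_frequency {n : ℕ} {s : ℝ} (hs : 0 < s)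
    {χ : EuclideanSpace ℝ (Fin n) → ℝ} (hχ : ContDiff ℝ ∞ χ) (hc : HasCompactSupport χ)
    (h1 : ∀ ξ, ‖ξ‖ < 1 → χ ξ = 1) :
    Integrable (fun ξ => ((‖ξ‖ ^ (2 * s) * χ ξ : ℝ) : ℂ)) ∧
    ∃ D > 0, ∀ x, ‖𝓕⁻ (fun ξ => ((‖ξ‖ ^ (2 * s) * χ ξ : ℝ) : ℂ)) x‖
      ≤ D * (1 + ‖x‖) ^ (-(n + 2 * s)) := by
  set L : EuclideanSpace ℝ (Fin n) → ℂ := fun ξ => ((‖ξ‖ ^ (2 * s) * χ ξ : ℝ) : ℂ) with hLdef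
  have hcont : Continuous fun ξ : EuclideanSpace ℝ (Fin n) => ‖ξ‖ ^ (2 * s) * χ ξ :=
    (continuous_norm.rpow_const fun _ => Or.inr (by positivity)).mul hχ.continuous
  have hL : Integrable L := (hcont.integrable_of_hasCompactSupport hc.mul_left).ofReal
  refine ⟨hL, ?_⟩
  let d : EuclideanSpace ℝ (Fin n) → ℝ := fun ξ => ‖ξ‖ ^ (2 * s) * (χ ξ - χ ((2 : ℝ) • ξ))
  have hχ2 : HasCompactSupport fun ξ => χ ((2 : ℝ) • ξ) := hc.comp_smul two_ne_zero
  have hdc : HasCompactSupport d := (hc.sub hχ2).mul_left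
  have hds : ContDiff ℝ ∞ d := by
    refine contDiff_iff_contDiffAt.2 fun ξ => ?_
    by_cases hξ : ξ = 0
    · subst hξ
      have : d =ᶠ[nhds 0] fun _ => 0 := by
        filter_upwards [Metric.ball_mem_nhds (0 : EuclideanSpace ℝ (Fin n))
          (show (0 : ℝ) < 1 / 2 by norm_num)] with ξ hξ
        rw [mem_ball_zero_iff] at hξ
        have h2 : ‖(2 : ℝ) • ξ‖ < 1 := by
          rw [norm_smul, Real.norm_ofNat]; linarith
        simp [d, h1 ξ (by linarith), h1 _ h2]
      exact contDiffAt_const.congr_of_eventuallyEq this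
    · have h3 : ContDiffAt ℝ ∞ (fun ξ : EuclideanSpace ℝ (Fin n) => ‖ξ‖ ^ (2 * s)) ξ :=
        (contDiffAt_norm ℝ hξ).rpow_const_of_ne (norm_ne_zero_iff.2 hξ)
      exact h3.mul (hχ.contDiffAt.sub (by fun_prop))
  have hdil : ∀ x, 𝓕⁻ L x - (2 ^ (-(n + 2 * s)) : ℝ) * 𝓕⁻ L ((2 : ℝ)⁻¹ • x)
      = 𝓕⁻ (schwartzOfReal hds hdc) x := fun x => by
    rw [SchwartzMap.fourierInv_coe]
    have h4 : (schwartzOfReal hds hdc : EuclideanSpace ℝ (Fin n) → ℂ)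
        = fun ξ => L ξ + ((-(2 ^ (-(2 * s))) : ℝ) : ℂ) * L ((2 : ℝ) • ξ) := by
      funext ξ
      change ((d ξ : ℝ) : ℂ) = _
      simp only [d, hLdef]
      rw [norm_smul, Real.norm_ofNat, Real.mul_rpow (by norm_num) (norm_nonneg _),
        ← Complex.ofReal_mul, ← Complex.ofReal_add]
      congr 1
      have : (2 : ℝ) ^ (-(2 * s)) * 2 ^ (2 * s) = 1 := by
        rw [← Real.rpow_add (by norm_num)]; simp
      linear_combination (‖ξ‖ ^ (2 * s) * χ ((2 : ℝ) • ξ)) * this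
    have h5 : Integrable fun ξ => L ((2 : ℝ) • ξ) :=
      (integrable_comp_smul_iff volume L two_ne_zero).2 hL
    have h6 : ∀ c : ℂ, 𝓕⁻ (fun ξ => c * L ((2 : ℝ) • ξ)) x = c * 𝓕⁻ (fun ξ => L ((2 : ℝ) • ξ)) x := by
      intro c
      rw [Real.fourierInv_eq, Real.fourierInv_eq, ← integral_const_mul]
      refine integral_congr_ae (Filter.Eventually.of_forall fun v => ?_)
      simp only [Circle.smul_def, smul_eq_mul]
      ring
    rw [h4, fourierInv_fun_add hL (h5.const_mul _), h6, fourierInv_comp_smul L two_pos,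
      neg_add, Real.rpow_add two_pos, Real.rpow_neg two_pos.le, Real.rpow_natCast]
    push_cast
    ring
  obtain ⟨C, hC0, hC⟩ :=
    (𝓕⁻ (schwartzOfReal hds hdc)).exists_norm_le_one_add_norm_rpow ((n + 2 * s) + 1)
  refine decay_of_dyadic_recursion (M := ∫ ξ, ‖L ξ‖) (by positivity) (fun x => ?_)
    (fun x => ?_) hC0
  · rw [Real.fourierInv_eq_fourier_neg]
    exact VectorFourier.norm_fourierIntegral_le_integral_norm _ _ _ _ _
  · rw [hdil]; exact hC x

/-- The fractional Laplacian of a test function is `O(|x|^{-n-2s})` at infinity. -/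
theorem exists_decay_fracLaplacian {n : ℕ} {s : ℝ} (hs : 0 < s)
    {φ : EuclideanSpace ℝ (Fin n) → ℝ} (hφ : ContDiff ℝ ∞ φ) (hc : HasCompactSupport φ) :
    ∃ C > 0, ∀ x, |fracLaplacian s φ x| ≤ C * (1 + ‖x‖) ^ (-(n + 2 * s)) := by
  obtain ⟨χ, hχ, hχc, hχ1, hhigh⟩ := exists_frequency_cutoff n s
  obtain ⟨hL, D, hD0, hD⟩ := exists_decay_fourierInv_low_frequency hs hχ hχc hχ1
  set L : EuclideanSpace ℝ (Fin n) → ℂ := fun ξ => ((‖ξ‖ ^ (2 * s) * χ ξ : ℝ) : ℂ) with hLdef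
  set F := schwartzOfReal hφ hc
  set H := SchwartzMap.smulLeftCLM ℂ (fun ξ : EuclideanSpace ℝ (Fin n) =>
    ‖ξ‖ ^ (2 * s) * (1 - χ ξ)) (𝓕 F) with hH
  obtain ⟨C, hC0, hC⟩ := (𝓕⁻ H).exists_norm_le_one_add_norm_rpow (n + 2 * s)
  obtain ⟨r, hr0, hr⟩ : ∃ r > 0, tsupport φ ⊆ Metric.closedBall 0 r := by
    obtain ⟨r, hr⟩ := hc.isCompact.isBounded.subset_closedBall 0
    exact ⟨max r 1, by positivity, hr.trans (Metric.closedBall_subset_closedBall (le_max_left _ _))⟩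
  have hLF : Integrable fun ξ => L ξ * 𝓕 F ξ :=
    hL.mul_bdd (c := ‖(𝓕 F).toBoundedContinuousFunction‖) (𝓕 F).continuous.aestronglyMeasurable
      (Filter.Eventually.of_forall fun ξ => (𝓕 F).toBoundedContinuousFunction.norm_coe_le_norm ξ)
  have hsplit : ∀ x, fracLaplacian s φ x = (((2 * Real.pi) ^ (2 * s) : ℝ) *
      (𝓕⁻ H x + ∫ y, F y * 𝓕⁻ L (x - y))).re := fun x => by
    rw [fracLaplacian_eq, ← fourierInv_mul_fourier_eq_integral hL F.integrable,
      SchwartzMap.fourierInv_coe]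
    congr 1
    have h2 : (fun ξ => fracSymbol s ξ * 𝓕 (fun y => ((φ y : ℝ) : ℂ)) ξ)
        = fun ξ => (((2 * Real.pi) ^ (2 * s) : ℝ) : ℂ) * (H ξ + L ξ * 𝓕 F ξ) := by
      funext ξ
      rw [hH, SchwartzMap.smulLeftCLM_apply_apply hhigh]
      change _ = (((2 * Real.pi) ^ (2 * s) : ℝ) : ℂ) * (_ • 𝓕 (fun y => ((φ y : ℝ) : ℂ)) ξ
        + L ξ * 𝓕 (fun y => ((φ y : ℝ) : ℂ)) ξ)
      simp only [fracSymbol, hLdef, Complex.real_smul]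
      rw [Real.mul_rpow (by positivity) (norm_nonneg _)]
      push_cast
      ring
    rw [h2]
    have h3 := fourierInv_fun_add H.integrable hLF x
    calc _ = (((2 * Real.pi) ^ (2 * s) : ℝ) : ℂ) * 𝓕⁻ (fun ξ => H ξ + L ξ * 𝓕 F ξ) x := by
          rw [Real.fourierInv_eq, Real.fourierInv_eq, ← integral_const_mul]
          refine integral_congr_ae (Filter.Eventually.of_forall fun v => ?_)
          simp only [Circle.smul_def, smul_eq_mul]
          ring
      _ = _ := by rw [h3]; rfl
  set I := ∫ y, ‖F y‖
  have hI : 0 ≤ I := integral_nonneg fun _ => norm_nonneg _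
  refine ⟨(2 * Real.pi) ^ (2 * s) * (C + I * (D * (1 + r) ^ (n + 2 * s))), by positivity,
    fun x => ?_⟩
  rw [hsplit]
  refine (Complex.abs_re_le_norm _).trans ?_
  rw [norm_mul, Complex.norm_real, Real.norm_of_nonneg (by positivity), mul_assoc]
  refine mul_le_mul_of_nonneg_left ?_ (by positivity)
  refine (norm_add_le _ _).trans ?_
  rw [add_mul]
  refine add_le_add (hC x) ?_
  rw [mul_assoc, ← integral_mul_const]
  refine norm_integral_le_of_norm_le (F.integrable.norm.mul_const _)
    (Filter.Eventually.of_forall fun y => ?_)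
  rw [norm_mul]
  by_cases hy : φ y = 0
  · have : F y = 0 := by change ((φ y : ℝ) : ℂ) = 0; simp [hy]
    simp [this]
  have hyr : ‖y‖ ≤ r := mem_closedBall_zero_iff.1 (hr (subset_tsupport φ hy))
  refine mul_le_mul_of_nonneg_left ((hD _).trans ?_) (norm_nonneg _)
  rw [mul_assoc]
  refine mul_le_mul_of_nonneg_left ?_ hD0.le
  have h4 : 1 + ‖x‖ ≤ (1 + r) * (1 + ‖x - y‖) := by
    have := norm_sub_norm_le x y
    nlinarith [norm_nonneg (x - y)]
  have h5 : (1 + ‖x‖) ^ (n + 2 * s) ≤ (1 + r) ^ (n + 2 * s) * (1 + ‖x - y‖) ^ (n + 2 * s) := by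
    rw [← Real.mul_rpow (by positivity) (by positivity)]
    exact Real.rpow_le_rpow (by positivity) h4 (by positivity)
  rw [Real.rpow_neg (by positivity), Real.rpow_neg (by positivity), ← div_eq_mul_inv,
    le_div_iff₀ (by positivity), inv_mul_le_iff₀ (by positivity)]
  linarith

/-! ### Integer powers of the Laplacian -/

lemma fourier_neg_laplacian_apply {n : ℕ} (f : 𝓢(EuclideanSpace ℝ (Fin n), ℂ))
    (ξ : EuclideanSpace ℝ (Fin n)) :
    𝓕 (-(Δ f)) ξ = fracSymbol 1 ξ * 𝓕 f ξ := by
  have hg : (fun ξ : EuclideanSpace ℝ (Fin n) => ‖ξ‖ ^ 2).HasTemperateGrowth := by fun_prop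
  rw [SchwartzMap.laplacian_eq_fourierMultiplierCLM, SchwartzMap.fourierMultiplierCLM_apply,
    neg_smul, neg_neg, FourierTransform.fourier_smul, FourierTransform.fourier_fourierInv_eq,
    smul_apply]
  erw [SchwartzMap.smulLeftCLM_apply_apply hg]
  simp only [fracSymbol, Complex.real_smul, mul_one, Real.rpow_two]
  push_cast
  ring

lemma fracSymbol_natCast_succ {n : ℕ} (k : ℕ) (ξ : EuclideanSpace ℝ (Fin n)) :
    fracSymbol ((k + 1 : ℕ) : ℝ) ξ = fracSymbol 1 ξ * fracSymbol k ξ := by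
  have h : ∀ j : ℕ, (2 * Real.pi * ‖ξ‖) ^ (2 * (j : ℝ)) = (2 * Real.pi * ‖ξ‖) ^ (2 * j) := by
    intro j
    rw [← Real.rpow_natCast]
    push_cast
    rfl
  have h1 := h 1
  simp only [Nat.cast_one] at h1
  simp only [fracSymbol]
  rw [h, h, h1]
  push_cast
  ring

/-- For an integer exponent the fractional Laplacian is the iterated classical one. -/
lemma fracLaplacian_natCast {n : ℕ} (k : ℕ) {φ : EuclideanSpace ℝ (Fin n) → ℝ}
    (hφ : ContDiff ℝ ∞ φ) (hc : HasCompactSupport φ) (x : EuclideanSpace ℝ (Fin n)) :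
    fracLaplacian (k : ℝ) φ x = (((fun f => -(Δ f))^[k] (schwartzOfReal hφ hc)) x).re := by
  have h : ∀ ξ, 𝓕 ((fun f => -(Δ f))^[k] (schwartzOfReal hφ hc)) ξ
      = fracSymbol (k : ℝ) ξ * 𝓕 (schwartzOfReal hφ hc) ξ := by
    induction k with
    | zero => intro ξ; simp [fracSymbol]
    | succ k ih =>
      intro ξ
      rw [Function.iterate_succ_apply', fourier_neg_laplacian_apply, ih, fracSymbol_natCast_succ,
        mul_assoc]
  rw [fracLaplacian_eq]
  have h2 : (fun ξ => fracSymbol (k : ℝ) ξ * 𝓕 (fun y => ((φ y : ℝ) : ℂ)) ξ)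
      = 𝓕 ((fun f => -(Δ f))^[k] (schwartzOfReal hφ hc)) := funext fun ξ => (h ξ).symm
  rw [h2, ← SchwartzMap.fourierInv_coe, FourierTransform.fourierInv_fourier_eq]

lemma lineDeriv_eq_pow_mul {n : ℕ} {c g : EuclideanSpace ℝ (Fin n) → ℂ} (hc : ContDiff ℝ ∞ c)
    (hg : ContDiff ℝ ∞ g) (a : ℕ) (f : 𝓢(EuclideanSpace ℝ (Fin n), ℂ))
    (hf : ∀ x, f x = c x ^ (a + 1) * g x) (v : EuclideanSpace ℝ (Fin n)) :
    ∃ g' : EuclideanSpace ℝ (Fin n) → ℂ, ContDiff ℝ ∞ g' ∧ ∀ x, (∂_{v} f) x = c x ^ a * g' x := by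
  refine ⟨fun x => (a + 1) * fderiv ℝ c x v * g x + c x * fderiv ℝ g x v, ?_, fun x => ?_⟩
  · have h1 : ContDiff ℝ ∞ (fun x => fderiv ℝ c x v) :=
      (hc.fderiv_right (m := ∞) (by simp)).clm_apply contDiff_const
    have h2 : ContDiff ℝ ∞ (fun x => fderiv ℝ g x v) :=
      (hg.fderiv_right (m := ∞) (by simp)).clm_apply contDiff_const
    fun_prop
  · rw [SchwartzMap.lineDerivOp_apply_eq_fderiv]
    have h1 : HasFDerivAt c (fderiv ℝ c x) x :=
      (hc.differentiable (by simp) x).hasFDerivAt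
    have h2 : HasFDerivAt g (fderiv ℝ g x) x :=
      (hg.differentiable (by simp) x).hasFDerivAt
    have h3 := ((h1.pow (a + 1)).mul h2).fderiv
    have h4 : (f : EuclideanSpace ℝ (Fin n) → ℂ) = (fun x => c x ^ (a + 1)) * g := funext hf
    rw [h4, h3]
    simp
    ring

lemma lineDeriv_eq_zero_of_eqOn_const {n : ℕ} {U : Set (EuclideanSpace ℝ (Fin n))} (hU : IsOpen U)
    {f : 𝓢(EuclideanSpace ℝ (Fin n), ℂ)} {z : ℂ} (hf : ∀ x ∈ U, f x = z)
    (v : EuclideanSpace ℝ (Fin n)) : ∀ x ∈ U, (∂_{v} f) x = 0 := by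
  intro x hx
  rw [SchwartzMap.lineDerivOp_apply_eq_fderiv]
  have : (f : EuclideanSpace ℝ (Fin n) → ℂ) =ᶠ[nhds x] fun _ => z := by
    filter_upwards [hU.mem_nhds hx] with y hy using hf y hy
  rw [this.fderiv_eq]
  simp

/-- Applying the Laplacian `k` times to a power of `c` keeps all but `2k` of the factors, and gives
zero where that power is constant. -/
lemma iterate_neg_laplacian_pow {n : ℕ} {c : EuclideanSpace ℝ (Fin n) → ℂ} (hc : ContDiff ℝ ∞ c)
    {U : Set (EuclideanSpace ℝ (Fin n))} (hU : IsOpen U) (k : ℕ) :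
    ∀ (a : ℕ) (f : 𝓢(EuclideanSpace ℝ (Fin n), ℂ)) (z : ℂ), (∀ x, f x = c x ^ (a + 2 * k)) →
      (∀ x ∈ U, f x = z) →
      (∃ g : EuclideanSpace ℝ (Fin n) → ℂ, ContDiff ℝ ∞ g ∧
        ∀ x, ((fun f => -(Δ f))^[k] f) x = c x ^ a * g x) ∧
      ∃ z', (0 < k → z' = 0) ∧ ∀ x ∈ U, ((fun f => -(Δ f))^[k] f) x = z' := by
  induction k with
  | zero =>
    intro a f z hf hz
    exact ⟨⟨fun _ => 1, contDiff_const, fun x => by simp [hf]⟩, z, by simp, hz⟩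
  | succ k ih =>
    intro a f z hf hz
    obtain ⟨⟨g, hg, hfg⟩, z', -, hz'⟩ := ih (a + 2) f z
      (fun x => by rw [hf]; congr 1; ring) hz
    set F := (fun f => -(Δ f))^[k] f
    have hstep : ∀ x, ((fun f => -(Δ f))^[k + 1] f) x = -∑ i,
        (∂_{EuclideanSpace.basisFun (Fin n) ℝ i} (∂_{EuclideanSpace.basisFun (Fin n) ℝ i} F)) x := by
      intro x
      rw [Function.iterate_succ_apply',
        SchwartzMap.laplacian_eq_sum (EuclideanSpace.basisFun (Fin n) ℝ), neg_apply,
        sum_apply]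
    constructor
    · have h1 : ∀ i, ∃ g' : EuclideanSpace ℝ (Fin n) → ℂ, ContDiff ℝ ∞ g' ∧ ∀ x,
          (∂_{EuclideanSpace.basisFun (Fin n) ℝ i} (∂_{EuclideanSpace.basisFun (Fin n) ℝ i} F)) x
            = c x ^ a * g' x := by
        intro i
        obtain ⟨g₁, hg₁, h₁⟩ := lineDeriv_eq_pow_mul hc hg (a + 1) F hfg
          (EuclideanSpace.basisFun (Fin n) ℝ i)
        exact lineDeriv_eq_pow_mul hc hg₁ a _ h₁ _
      choose g' hg' h' using h1
      refine ⟨fun x => -∑ i, g' i x, (ContDiff.sum fun i _ => hg' i).neg, fun x => ?_⟩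
      rw [hstep]
      simp only [h', mul_neg, Finset.mul_sum]
    · refine ⟨0, fun _ => rfl, fun x hx => ?_⟩
      rw [hstep, neg_eq_zero]
      refine Finset.sum_eq_zero fun i _ => ?_
      exact lineDeriv_eq_zero_of_eqOn_const hU
        (lineDeriv_eq_zero_of_eqOn_const hU hz' _) _ x hx

/-! ### Powers of bump functions as cutoffs -/

lemma exists_abs_pow_mul_le {X : Type*} [TopologicalSpace X] {f g : X → ℝ}
    (hc : HasCompactSupport f) (hf0 : ∀ x, 0 ≤ f x) (hf1 : ∀ x, f x ≤ 1) (hg : Continuous g)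
    {a l : ℕ} {p : ℝ} (ha : 0 < a) (hal : l / p ≤ a) :
    ∃ A > 0, ∀ x, |f x ^ a * g x| ≤ A * (f x ^ l) ^ (1 / p) := by
  obtain ⟨A, hA⟩ := hc.isCompact.exists_bound_of_continuousOn hg.continuousOn
  refine ⟨|A| + 1, by positivity, fun x => ?_⟩
  rcases (hf0 x).eq_or_lt with h0 | h0
  · rw [← h0, zero_pow ha.ne', zero_mul, abs_zero]
    positivity
  rw [abs_mul, abs_of_nonneg (by positivity), mul_comm]
  refine mul_le_mul ?_ ?_ (by positivity) (by positivity)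
  · exact (hA x (subset_tsupport f h0.ne')).trans ((le_abs_self A).trans (by linarith))
  · rw [← Real.rpow_natCast, ← Real.rpow_natCast, ← Real.rpow_mul h0.le, mul_one_div]
    exact Real.rpow_le_rpow_of_exponent_ge h0 (hf1 x) hal

lemma exists_nat_div_le_sub {p : ℝ} (hp : 1 < p) (M : ℕ) :
    ∃ a : ℕ, 0 < a ∧ ∀ j ≤ M, ((a + M : ℕ) : ℝ) / p ≤ ((a + M - j : ℕ) : ℝ) ∧ 0 < a + M - j := by
  obtain ⟨a, ha⟩ := exists_nat_ge (M / (p - 1))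
  refine ⟨a + 1, by omega, fun j hj => ⟨?_, by omega⟩⟩
  have h1 : (a + 1 : ℝ) ≤ ((a + 1 + M - j : ℕ) : ℝ) := by
    exact_mod_cast (by omega : a + 1 ≤ a + 1 + M - j)
  refine le_trans ?_ h1
  rw [div_le_iff₀ (by linarith)] at ha ⊢
  push_cast
  nlinarith

/-- A compactly supported profile, equal to `1` near the origin, whose images under the first
integer powers of the Laplacian are controlled by its `1/p`-th power. -/
theorem exists_local_profile (n N : ℕ) {p ρ : ℝ} (hp : 1 < p) (hρ : 0 < ρ) (hρ1 : ρ < 1) :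
    ∃ φ : EuclideanSpace ℝ (Fin n) → ℝ, ContDiff ℝ ∞ φ ∧ HasCompactSupport φ ∧ (∀ x, 0 ≤ φ x) ∧
      (∀ x, φ x ≤ 1) ∧ (∀ x, ‖x‖ < ρ → φ x = 1) ∧ (∀ x, 1 ≤ ‖x‖ → φ x = 0) ∧
      ∀ j : ℕ, 0 < j → j ≤ N →
        (∃ A > 0, ∀ x, |fracLaplacian (j : ℝ) φ x| ≤ A * φ x ^ (1 / p)) ∧
        ∀ x, ‖x‖ < ρ → fracLaplacian (j : ℝ) φ x = 0 := by
  let χ : ContDiffBump (0 : EuclideanSpace ℝ (Fin n)) := ⟨ρ, 1, hρ, hρ1⟩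
  obtain ⟨a, ha, hal⟩ := exists_nat_div_le_sub hp (2 * N)
  set l := a + 2 * N
  have hl : l ≠ 0 := by omega
  have hs : ContDiff ℝ ∞ fun x => χ x ^ l := χ.contDiff.pow l
  have hc : HasCompactSupport fun x => χ x ^ l :=
    χ.hasCompactSupport.comp_left (g := fun r : ℝ => r ^ l) (zero_pow hl)
  have h1 : ∀ x, ‖x‖ < ρ → χ x = 1 := fun x hx =>
    χ.one_of_mem_closedBall (mem_closedBall_zero_iff.2 hx.le)
  refine ⟨fun x => χ x ^ l, hs, hc, fun x => pow_nonneg χ.nonneg _,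
    fun x => pow_le_one₀ χ.nonneg χ.le_one, fun x hx => by simp [h1 x hx], fun x hx => ?_,
    fun j hj0 hjN => ?_⟩
  · have : χ x = 0 := χ.zero_of_le_dist (by rwa [dist_zero_right])
    simp [this, hl]
  have hcs : ContDiff ℝ ∞ fun x => ((χ x : ℝ) : ℂ) := Complex.ofRealCLM.contDiff.comp χ.contDiff
  obtain ⟨⟨g, hg, hfg⟩, z, hz0, hz⟩ := iterate_neg_laplacian_pow hcs
    (Metric.isOpen_ball (x := (0 : EuclideanSpace ℝ (Fin n))) (ε := ρ)) j (l - 2 * j)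
    (schwartzOfReal hs hc) 1
    (fun x => by
      change ((χ x ^ l : ℝ) : ℂ) = _
      rw [Nat.sub_add_cancel (by omega)]
      push_cast
      rfl)
    (fun x hx => by
      change ((χ x ^ l : ℝ) : ℂ) = _
      simp [h1 x (mem_ball_zero_iff.1 hx)])
  constructor
  · obtain ⟨h2, h3⟩ := hal (2 * j) (by omega)
    obtain ⟨A, hA0, hA⟩ := exists_abs_pow_mul_le χ.hasCompactSupport (fun x => χ.nonneg)
      (fun x => χ.le_one) (Complex.continuous_re.comp hg.continuous) h3 h2
    refine ⟨A, hA0, fun x => ?_⟩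
    rw [fracLaplacian_natCast j hs hc, hfg, ← Complex.ofReal_pow, Complex.re_ofReal_mul]
    exact hA x
  · intro x hx
    rw [fracLaplacian_natCast j hs hc, hz x (mem_ball_zero_iff.2 hx), hz0 hj0, Complex.zero_re]

lemma iteratedDeriv_pow_eq {θ : ℝ → ℝ} (hθ : ContDiff ℝ ∞ θ) (k : ℕ) :
    ∀ a : ℕ, ∃ g : ℝ → ℝ, ContDiff ℝ ∞ g ∧
      iteratedDeriv k (fun t => θ t ^ (a + k)) = fun t => θ t ^ a * g t := by
  induction k with
  | zero => exact fun a => ⟨fun _ => 1, contDiff_const, by simp⟩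
  | succ k ih =>
    intro a
    obtain ⟨g, hg, h⟩ := ih (a + 1)
    refine ⟨fun t => (a + 1) * deriv θ t * g t + θ t * deriv g t, ?_, ?_⟩
    · have h1 : ContDiff ℝ ∞ (deriv θ) := (contDiff_infty_iff_deriv.1 hθ).2
      have h2 : ContDiff ℝ ∞ (deriv g) := (contDiff_infty_iff_deriv.1 hg).2
      fun_prop
    · rw [iteratedDeriv_succ, show a + (k + 1) = a + 1 + k by ring, h]
      funext t
      have h1 : HasDerivAt θ (deriv θ t) t := (hθ.differentiable (by simp) t).hasDerivAt
      have h2 : HasDerivAt g (deriv g t) t := (hg.differentiable (by simp) t).hasDerivAt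
      have h3 := ((h1.pow (a + 1)).mul h2).deriv
      have h4 : (fun t => θ t ^ (a + 1) * g t) = θ ^ (a + 1) * g := rfl
      rw [h4, h3]
      simp
      ring

/-- A temporal cutoff, equal to `1` on `(-1/2, 1/2)` and to `0` off `(-1, 1)`, whose derivatives up
to the third order are controlled by its `1/p`-th power. -/
structure IsTimeCutoff (p B : ℝ) (ζ : ℝ → ℝ) : Prop where
  smooth : ContDiff ℝ ∞ ζ
  nonneg : ∀ t, 0 ≤ ζ t
  le_one : ∀ t, ζ t ≤ 1
  eq_one : ∀ t, |t| < 1 / 2 → ζ t = 1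
  eq_zero : ∀ t, 1 ≤ |t| → ζ t = 0
  deriv_eq_zero : ∀ t, |t| < 1 / 2 → ∀ k, 0 < k → iteratedDeriv k ζ t = 0
  deriv_le : ∀ k ≤ 3, ∀ t, |iteratedDeriv k ζ t| ≤ B * ζ t ^ (1 / p)

lemma exists_isTimeCutoff {p : ℝ} (hp : 1 < p) : ∃ B > 0, ∃ ζ, IsTimeCutoff p B ζ := by
  let θ : ContDiffBump (0 : ℝ) := ⟨1 / 2, 1, by norm_num, by norm_num⟩
  obtain ⟨a, ha, hal⟩ := exists_nat_div_le_sub hp 3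
  set l := a + 3
  have hl : l ≠ 0 := by omega
  have h1 : ∀ t : ℝ, |t| < 1 / 2 → θ t = 1 := fun t ht =>
    θ.one_of_mem_closedBall (mem_closedBall_zero_iff.2 ht.le)
  suffices hder : ∃ A > 0, ∀ k ≤ 3, ∀ t, |iteratedDeriv k (fun t => θ t ^ l) t|
      ≤ A * (θ t ^ l) ^ (1 / p) by
    obtain ⟨B, hB, hder⟩ := hder
    refine ⟨B, hB, fun t => θ t ^ l, θ.contDiff.pow l, fun t => pow_nonneg θ.nonneg _,
      fun t => pow_le_one₀ θ.nonneg θ.le_one, fun t ht => by simp [h1 t ht], fun t ht => ?_,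
      fun t ht k hk => ?_, hder⟩
    · have : θ t = 0 := θ.zero_of_le_dist (by rwa [dist_zero_right])
      simp [this, hl]
    · have : (fun t => θ t ^ l) =ᶠ[nhds t] fun _ => 1 := by
        filter_upwards [(isOpen_lt continuous_abs continuous_const).mem_nhds ht] with s hs
        simp [h1 s hs]
      rw [this.iteratedDeriv_eq]
      simp [iteratedDeriv_const, hk.ne']
  have : ∀ k, ∃ A > 0, k ≤ 3 → ∀ t, |iteratedDeriv k (fun t => θ t ^ l) t|
      ≤ A * (θ t ^ l) ^ (1 / p) := by
    intro k
    by_cases hk : k ≤ 3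
    · obtain ⟨g, hg, h⟩ := iteratedDeriv_pow_eq θ.contDiff k (l - k)
      rw [Nat.sub_add_cancel (by omega)] at h
      obtain ⟨h2, h3⟩ := hal k hk
      obtain ⟨A, hA0, hA⟩ := exists_abs_pow_mul_le θ.hasCompactSupport (fun x => θ.nonneg)
        (fun x => θ.le_one) hg.continuous h3 h2
      exact ⟨A, hA0, fun _ t => by rw [h]; exact hA t⟩
    · exact ⟨1, one_pos, fun h => absurd h hk⟩
  choose A hA0 hA using this
  refine ⟨∑ k ∈ Finset.range 4, A k,
    Finset.sum_pos (fun k _ => hA0 k) (by simp), fun k hk t => (hA k hk t).trans ?_⟩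
  refine mul_le_mul_of_nonneg_right ?_ (Real.rpow_nonneg (pow_nonneg θ.nonneg _) _)
  exact Finset.single_le_sum (fun k _ => (hA0 k).le) (Finset.mem_range.2 (by omega))

/-! ### Spatial profiles -/

/-- The pointwise size of a profile together with the fractional Laplacians of it that the adjoint
operator produces. -/
noncomputable def profileSize {n : ℕ} (σ : ℝ) (φ : EuclideanSpace ℝ (Fin n) → ℝ)
    (x : EuclideanSpace ℝ (Fin n)) : ℝ :=
  |φ x| + |fracLaplacian σ φ x| + |fracLaplacian (σ / 3) φ x| + |fracLaplacian (2 * σ / 3) φ x|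

lemma profileSize_nonneg {n : ℕ} (σ : ℝ) (φ : EuclideanSpace ℝ (Fin n) → ℝ)
    (x : EuclideanSpace ℝ (Fin n)) : 0 ≤ profileSize σ φ x := by
  unfold profileSize; positivity

/-- A spatial profile for the test function method: a nonnegative test function, constant on the
ball of radius `ρ`, whose size is bounded by `φ^{1/p} w^{1-1/p}` on the ball of radius `L`
(so that it can be absorbed by the nonlinearity) and by a multiple of the tail weight `v` outside.
All bounds carry the same constant `A`. -/
structure IsProfile {n : ℕ} (σ p A ρ L : ℝ) (w v φ : EuclideanSpace ℝ (Fin n) → ℝ) : Prop where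
  smooth : ContDiff ℝ ∞ φ
  compact : HasCompactSupport φ
  nonneg : ∀ x, 0 ≤ φ x
  one_le : 1 ≤ φ 0
  eq_of_lt : ∀ x, ‖x‖ < ρ → φ x = φ 0
  size_le : ∀ x, profileSize σ φ x ≤ A
  size_inner : ∀ x, ‖x‖ ≤ L → profileSize σ φ x ≤ A * (φ x ^ (1 / p) * w x ^ (1 - 1 / p))
  size_outer : ∀ x, L < ‖x‖ → profileSize σ φ x ≤ A * v x

/-- The partial sums `∑_{j ≤ K} 2^{-jb} ψ(x/2^j)`. They increase to a positive function comparable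
to `(1+|x|)^{-b}`, while each of them is a test function if `ψ` is. -/
noncomputable def dyadicSum {n : ℕ} (b : ℝ) (ψ : EuclideanSpace ℝ (Fin n) → ℝ) :
    ℕ → EuclideanSpace ℝ (Fin n) → ℝ
  | 0 => ψ
  | K + 1 => fun x => ψ x + 2 ^ (-b) * dyadicSum b ψ K ((2 : ℝ)⁻¹ • x)

lemma contDiff_dyadicSum {n : ℕ} (b : ℝ) {ψ : EuclideanSpace ℝ (Fin n) → ℝ} (hψ : ContDiff ℝ ∞ ψ)
    (K : ℕ) : ContDiff ℝ ∞ (dyadicSum b ψ K) := by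
  induction K with
  | zero => exact hψ
  | succ K ih => unfold dyadicSum; fun_prop

lemma hasCompactSupport_dyadicSum {n : ℕ} (b : ℝ) {ψ : EuclideanSpace ℝ (Fin n) → ℝ}
    (hψ : HasCompactSupport ψ) (K : ℕ) : HasCompactSupport (dyadicSum b ψ K) := by
  induction K with
  | zero => exact hψ
  | succ K ih => exact hψ.add ((ih.comp_smul (by norm_num)).mul_left)

lemma norm_two_inv_smul {n : ℕ} (x : EuclideanSpace ℝ (Fin n)) : ‖(2 : ℝ)⁻¹ • x‖ = ‖x‖ / 2 := by
  rw [norm_smul, norm_inv, Real.norm_ofNat]; ring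

lemma two_rpow_neg_mul_rpow {b r : ℝ} (hr : 0 ≤ r) : r ^ b * 2 ^ (-b) = (r / 2) ^ b := by
  rw [Real.div_rpow hr (by norm_num), Real.rpow_neg (by norm_num)]; rfl

lemma dyadicSum_bounds {n : ℕ} {b ρ : ℝ} (hb : 0 < b) (hρ : 0 < ρ) {ψ : EuclideanSpace ℝ (Fin n) → ℝ}
    (h0 : ∀ x, 0 ≤ ψ x) (h1 : ∀ x, ψ x ≤ 1) (hρ1 : ∀ x, ‖x‖ ≤ ρ → ψ x = 1)
    (hz : ∀ x, 1 ≤ ‖x‖ → ψ x = 0) (K : ℕ) :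
    (∀ x, 0 ≤ dyadicSum b ψ K x) ∧ 1 ≤ dyadicSum b ψ K 0 ∧
    (∀ x, ‖x‖ ≤ ρ → dyadicSum b ψ K x = dyadicSum b ψ K 0) ∧
    (∀ x, dyadicSum b ψ K x ≤ (1 - 2 ^ (-b))⁻¹) ∧
    (∀ x, ‖x‖ ^ b * dyadicSum b ψ K x ≤ (1 - 2 ^ (-b))⁻¹) ∧
    (∀ x, ρ ≤ ‖x‖ → ‖x‖ ≤ 2 ^ K * ρ → (ρ / 2) ^ b ≤ ‖x‖ ^ b * dyadicSum b ψ K x) := by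
  have hq0 : (0 : ℝ) < 2 ^ (-b) := by positivity
  have hq1 : (2 : ℝ) ^ (-b) < 1 := Real.rpow_lt_one_of_one_lt_of_neg one_lt_two (by linarith)
  have hc1 : 1 ≤ (1 - (2 : ℝ) ^ (-b))⁻¹ := (one_le_inv₀ (by linarith)).2 (by linarith)
  have hceq : 1 + 2 ^ (-b) * (1 - (2 : ℝ) ^ (-b))⁻¹ = (1 - (2 : ℝ) ^ (-b))⁻¹ := by
    have : 1 - (2 : ℝ) ^ (-b) ≠ 0 := by linarith
    field_simp
    ring
  have hle : ∀ (f : EuclideanSpace ℝ (Fin n) → ℝ) (x : EuclideanSpace ℝ (Fin n)),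
      ‖x‖ ≤ 1 → 0 ≤ f x → f x ≤ (1 - (2 : ℝ) ^ (-b))⁻¹ → ‖x‖ ^ b * f x ≤ (1 - 2 ^ (-b))⁻¹ := by
    intro f x hx hf0 hf
    exact (mul_le_of_le_one_left hf0 (Real.rpow_le_one (norm_nonneg _) hx hb.le)).trans hf
  induction K with
  | zero =>
    refine ⟨h0, (hρ1 0 (by simpa using hρ.le)).ge, fun x hx => ?_, fun x => (h1 x).trans hc1,
      fun x => ?_, fun x hx hx2 => ?_⟩
    · exact (hρ1 x hx).trans (hρ1 0 (by simpa using hρ.le)).symm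
    · rcases le_total 1 ‖x‖ with hx | hx
      · simp only [dyadicSum, hz x hx, mul_zero]; linarith
      · exact hle _ x hx (h0 x) ((h1 x).trans hc1)
    · rw [pow_zero, one_mul] at hx2
      simp only [dyadicSum, hρ1 x hx2, mul_one]
      exact Real.rpow_le_rpow (by positivity) (by linarith) hb.le
  | succ K ih =>
    obtain ⟨i0, i1, i2, i3, i4, i5⟩ := ih
    have hn0 : ∀ x, 0 ≤ dyadicSum b ψ (K + 1) x := fun x =>
      add_nonneg (h0 x) (mul_nonneg hq0.le (i0 _))
    have hub : ∀ x, dyadicSum b ψ (K + 1) x ≤ (1 - 2 ^ (-b))⁻¹ := fun x => by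
      rw [← hceq]
      exact add_le_add (h1 x) (mul_le_mul_of_nonneg_left (i3 _) hq0.le)
    have hlow : ∀ x, ‖x‖ ^ b * (2 ^ (-b) * dyadicSum b ψ K ((2 : ℝ)⁻¹ • x))
        = ‖(2 : ℝ)⁻¹ • x‖ ^ b * dyadicSum b ψ K ((2 : ℝ)⁻¹ • x) := fun x => by
      rw [← mul_assoc, two_rpow_neg_mul_rpow (norm_nonneg _), norm_two_inv_smul]
    refine ⟨hn0, ?_, fun x hx => ?_, hub, fun x => ?_, fun x hx hx2 => ?_⟩
    · have : ψ 0 = 1 := hρ1 0 (by simpa using hρ.le)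
      simp only [dyadicSum, this]
      have := mul_nonneg hq0.le (i0 ((2 : ℝ)⁻¹ • (0 : EuclideanSpace ℝ (Fin n))))
      linarith
    · simp only [dyadicSum]
      rw [hρ1 x hx, hρ1 0 (by simpa using hρ.le), smul_zero,
        i2 ((2 : ℝ)⁻¹ • x) (by rw [norm_two_inv_smul]; linarith)]
    · rcases le_total ‖x‖ 1 with hx | hx
      · exact hle _ x hx (hn0 x) (hub x)
      · simp only [dyadicSum, hz x hx, zero_add]
        rw [hlow]
        exact i4 _
    · have h2 : (ρ / 2) ^ b ≤ ‖x‖ ^ b * (2 ^ (-b) * dyadicSum b ψ K ((2 : ℝ)⁻¹ • x)) := by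
        rw [hlow]
        rcases le_total ρ ‖(2 : ℝ)⁻¹ • x‖ with h | h
        · refine i5 _ h ?_
          rw [norm_two_inv_smul]
          rw [pow_succ] at hx2
          linarith
        · rw [i2 _ h, ← mul_one ((ρ / 2) ^ b)]
          refine mul_le_mul ?_ i1 zero_le_one (by positivity)
          rw [norm_two_inv_smul]
          exact Real.rpow_le_rpow (by positivity) (by linarith) hb.le
      have h3 : 0 ≤ ‖x‖ ^ b * ψ x := mul_nonneg (by positivity) (h0 x)
      simp only [dyadicSum, mul_add]
      linarith

lemma abs_fracLaplacian_dyadicSum_le {n : ℕ} {b s C : ℝ} (hb : 0 < b) (hs : 0 < s)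
    {ψ : EuclideanSpace ℝ (Fin n) → ℝ} (hψ : ContDiff ℝ ∞ ψ) (hc : HasCompactSupport ψ)
    (hC : ∀ x, |fracLaplacian s ψ x| ≤ C * (1 + ‖x‖) ^ (-b)) (K : ℕ) :
    ∀ x, |fracLaplacian s (dyadicSum b ψ K) x|
      ≤ C * (1 - 2 ^ (-(2 * s)))⁻¹ * (1 + ‖x‖) ^ (-b) := by
  have hq0 : (0 : ℝ) < 2 ^ (-(2 * s)) := by positivity
  have hq1 : (2 : ℝ) ^ (-(2 * s)) < 1 :=
    Real.rpow_lt_one_of_one_lt_of_neg one_lt_two (by linarith)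
  have hC0 : 0 ≤ C := by
    have := (abs_nonneg _).trans (hC 0)
    simpa using this
  have hc1 : 1 ≤ (1 - (2 : ℝ) ^ (-(2 * s)))⁻¹ := (one_le_inv₀ (by linarith)).2 (by linarith)
  have hceq : 1 + 2 ^ (-(2 * s)) * (1 - (2 : ℝ) ^ (-(2 * s)))⁻¹
      = (1 - (2 : ℝ) ^ (-(2 * s)))⁻¹ := by
    have : 1 - (2 : ℝ) ^ (-(2 * s)) ≠ 0 := by linarith
    field_simp
    ring
  induction K with
  | zero =>
    intro x
    refine (hC x).trans (mul_le_mul_of_nonneg_right ?_ (by positivity))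
    exact le_mul_of_one_le_right hC0 hc1
  | succ K ih =>
    intro x
    have hsK := contDiff_dyadicSum b hψ K
    have hcK := hasCompactSupport_dyadicSum b hc K
    have hadd : fracLaplacian s (dyadicSum b ψ (K + 1)) x = fracLaplacian s ψ x
        + 2 ^ (-b) * (2 ^ (-(2 * s)) * fracLaplacian s (dyadicSum b ψ K) ((2 : ℝ)⁻¹ • x)) := by
      rw [← fracLaplacian_const_mul_comp_inv_smul s _ _ two_pos]
      exact fracLaplacian_add hs.le hψ hc
        (show ContDiff ℝ ∞ fun y => 2 ^ (-b) * dyadicSum b ψ K ((2 : ℝ)⁻¹ • y) by fun_prop)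
        ((hcK.comp_smul (by norm_num)).mul_left) x
    have h1 : 2 ^ (-b) * (1 + ‖(2 : ℝ)⁻¹ • x‖) ^ (-b) ≤ (1 + ‖x‖) ^ (-b) := by
      rw [norm_two_inv_smul, ← Real.mul_rpow (by norm_num) (by positivity)]
      exact Real.rpow_le_rpow_of_nonpos (by positivity) (by linarith) (by linarith)
    rw [hadd]
    refine (abs_add_le _ _).trans ?_
    rw [abs_mul, abs_mul, abs_of_pos hq0, abs_of_pos (show (0 : ℝ) < 2 ^ (-b) by positivity)]
    calc |fracLaplacian s ψ x| + 2 ^ (-b) * (2 ^ (-(2 * s)) *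
          |fracLaplacian s (dyadicSum b ψ K) ((2 : ℝ)⁻¹ • x)|)
        ≤ C * (1 + ‖x‖) ^ (-b) + 2 ^ (-b) * (2 ^ (-(2 * s)) *
          (C * (1 - 2 ^ (-(2 * s)))⁻¹ * (1 + ‖(2 : ℝ)⁻¹ • x‖) ^ (-b))) := by
          gcongr
          · exact hC x
          · exact ih _
      _ = C * (1 + ‖x‖) ^ (-b) + C * (2 ^ (-(2 * s)) * (1 - 2 ^ (-(2 * s)))⁻¹) *
          (2 ^ (-b) * (1 + ‖(2 : ℝ)⁻¹ • x‖) ^ (-b)) := by ring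
      _ ≤ C * (1 + ‖x‖) ^ (-b) + C * (2 ^ (-(2 * s)) * (1 - 2 ^ (-(2 * s)))⁻¹) *
          (1 + ‖x‖) ^ (-b) := by gcongr
      _ = C * (1 + 2 ^ (-(2 * s)) * (1 - 2 ^ (-(2 * s)))⁻¹) * (1 + ‖x‖) ^ (-b) := by ring
      _ = _ := by rw [hceq]

/-- Profiles comparable to `(1+|x|)^{-n-2σ/3}` on arbitrarily large balls, with uniform
constants. -/
theorem exists_nonlocal_profiles (n : ℕ) {σ p ρ : ℝ} (hσ : 0 < σ) (hp : 1 < p) (hρ : 0 < ρ)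
    (hρ1 : ρ < 1) :
    ∃ A > 0, ∀ L : ℝ, ∃ φ : EuclideanSpace ℝ (Fin n) → ℝ,
      IsProfile σ p A ρ L (fun x => (1 + ‖x‖) ^ (-((n : ℝ) + 2 * σ / 3)))
        (fun x => (1 + ‖x‖) ^ (-((n : ℝ) + 2 * σ / 3))) φ := by
  let χ : ContDiffBump (0 : EuclideanSpace ℝ (Fin n)) := ⟨ρ, 1, hρ, hρ1⟩
  set ψ : EuclideanSpace ℝ (Fin n) → ℝ := fun x => χ x
  have hψs : ContDiff ℝ ∞ ψ := χ.contDiff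
  have hψc : HasCompactSupport ψ := χ.hasCompactSupport
  set b : ℝ := (n : ℝ) + 2 * σ / 3 with hbdef
  have hb : 0 < b := by positivity
  have hfrac : ∀ s, σ / 3 ≤ s → ∃ C > 0, ∀ K x, |fracLaplacian s (dyadicSum b ψ K) x|
      ≤ C * (1 + ‖x‖) ^ (-b) := by
    intro s hs
    have hs0 : 0 < s := by linarith
    obtain ⟨C, hC0, hC⟩ := exists_decay_fracLaplacian hs0 hψs hψc
    have hq1 : (2 : ℝ) ^ (-(2 * s)) < 1 :=
      Real.rpow_lt_one_of_one_lt_of_neg one_lt_two (by linarith)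
    refine ⟨C * (1 - 2 ^ (-(2 * s)))⁻¹, mul_pos hC0 (inv_pos.2 (by linarith)),
      fun K => abs_fracLaplacian_dyadicSum_le hb hs0 hψs hψc (fun x => (hC x).trans ?_) K⟩
    refine mul_le_mul_of_nonneg_left ?_ hC0.le
    refine Real.rpow_le_rpow_of_exponent_le (by linarith [norm_nonneg x]) ?_
    rw [hbdef]
    linarith
  obtain ⟨C₁, hC₁, h₁⟩ := hfrac σ (by linarith)
  obtain ⟨C₂, hC₂, h₂⟩ := hfrac (σ / 3) le_rfl
  obtain ⟨C₃, hC₃, h₃⟩ := hfrac (2 * σ / 3) (by linarith)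
  have hbd := dyadicSum_bounds hb hρ (fun x => χ.nonneg) (fun x => χ.le_one)
    (fun x hx => χ.one_of_mem_closedBall (mem_closedBall_zero_iff.2 hx))
    (fun x hx => χ.zero_of_le_dist (by rwa [dist_zero_right]))
  have hq1 : (2 : ℝ) ^ (-b) < 1 := Real.rpow_lt_one_of_one_lt_of_neg one_lt_two (by linarith)
  set c₀ : ℝ := (1 - 2 ^ (-b))⁻¹ with hc₀
  have hc₀0 : 0 < c₀ := inv_pos.2 (by linarith)
  -- upper and lower comparison of the partial sums with the weight
  have hup : ∀ K x, dyadicSum b ψ K x ≤ 2 ^ b * c₀ * (1 + ‖x‖) ^ (-b) := by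
    intro K x
    obtain ⟨i0, -, -, i3, i4, -⟩ := hbd K
    rw [Real.rpow_neg (by positivity), ← div_eq_mul_inv, le_div_iff₀ (by positivity), mul_comm]
    rcases le_total ‖x‖ 1 with h | h
    · refine mul_le_mul ?_ (i3 x) (i0 x) (by positivity)
      exact Real.rpow_le_rpow (by positivity) (by linarith) hb.le
    · calc (1 + ‖x‖) ^ b * dyadicSum b ψ K x ≤ (2 * ‖x‖) ^ b * dyadicSum b ψ K x := by
            refine mul_le_mul_of_nonneg_right ?_ (i0 x)
            exact Real.rpow_le_rpow (by positivity) (by linarith) hb.le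
        _ = 2 ^ b * (‖x‖ ^ b * dyadicSum b ψ K x) := by
            rw [Real.mul_rpow (by norm_num) (by positivity)]; ring
        _ ≤ 2 ^ b * c₀ := by gcongr; exact i4 x
  set c₁ : ℝ := (2 / ρ) ^ b
  have hc₁ : 0 < c₁ := by positivity
  have hc₁1 : 1 ≤ c₁ := Real.one_le_rpow (by rw [le_div_iff₀ hρ]; linarith) hb.le
  have hlow : ∀ K x, ‖x‖ ≤ 2 ^ K * ρ → (1 + ‖x‖) ^ (-b) ≤ c₁ * dyadicSum b ψ K x := by
    intro K x hx
    obtain ⟨i0, i1, i2, -, -, i5⟩ := hbd K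
    rcases le_total ‖x‖ ρ with h | h
    · rw [i2 x h]
      have : (1 + ‖x‖) ^ (-b) ≤ 1 :=
        Real.rpow_le_one_of_one_le_of_nonpos (by linarith [norm_nonneg x]) (by linarith)
      nlinarith
    · rw [Real.rpow_neg (by positivity), inv_le_iff_one_le_mul₀ (by positivity)]
      have h5 := i5 x h hx
      have h6 : c₁ * (ρ / 2) ^ b = 1 := by
        rw [← Real.mul_rpow (by positivity) (by positivity),
          show 2 / ρ * (ρ / 2) = 1 by field_simp, Real.one_rpow]
      calc 1 = c₁ * (ρ / 2) ^ b := h6.symm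
        _ ≤ c₁ * (‖x‖ ^ b * dyadicSum b ψ K x) := by gcongr
        _ ≤ c₁ * ((1 + ‖x‖) ^ b * dyadicSum b ψ K x) := by
            have := i0 x
            gcongr
            linarith
        _ = _ := by ring
  set A₀ := 2 ^ b * c₀ + C₁ + C₂ + C₃ with hA₀
  have hA₀0 : 0 < A₀ := by positivity
  have hsize : ∀ K x, profileSize σ (dyadicSum b ψ K) x ≤ A₀ * (1 + ‖x‖) ^ (-b) := by
    intro K x
    have h0 := hup K x
    rw [← abs_of_nonneg ((hbd K).1 x)] at h0
    simp only [profileSize, hA₀, add_mul]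
    exact add_le_add (add_le_add (add_le_add h0 (h₁ K x)) (h₂ K x)) (h₃ K x)
  refine ⟨A₀ * c₁, by positivity, fun L => ?_⟩
  obtain ⟨K, hK⟩ := pow_unbounded_of_one_lt (L / ρ) (one_lt_two (α := ℝ))
  rw [div_lt_iff₀ hρ] at hK
  obtain ⟨i0, i1, i2, -⟩ := hbd K
  have hA : A₀ ≤ A₀ * c₁ := le_mul_of_one_le_right hA₀0.le hc₁1
  refine ⟨dyadicSum b ψ K, contDiff_dyadicSum b hψs K, hasCompactSupport_dyadicSum b hψc K, i0, i1,
    fun x hx => i2 x hx.le, fun x => ?_, fun x hx => ?_, fun x hx => ?_⟩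
  · refine (hsize K x).trans (le_trans ?_ hA)
    refine mul_le_of_le_one_right hA₀0.le ?_
    exact Real.rpow_le_one_of_one_le_of_nonpos (by linarith [norm_nonneg x]) (by linarith)
  · refine (hsize K x).trans ?_
    rw [mul_assoc]
    refine mul_le_mul_of_nonneg_left ?_ hA₀0.le
    set W := (1 + ‖x‖) ^ (-b)
    have hW : 0 < W := by positivity
    have hp0 : 0 < 1 / p := by positivity
    have hp1 : 1 / p ≤ 1 := by rw [div_le_one (by linarith)]; exact hp.le
    calc W = W ^ (1 / p) * W ^ (1 - 1 / p) := by rw [← Real.rpow_add hW]; simp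
      _ ≤ (c₁ * dyadicSum b ψ K x) ^ (1 / p) * W ^ (1 - 1 / p) := by
          gcongr
          exact hlow K x (hx.trans hK.le)
      _ = c₁ ^ (1 / p) * (dyadicSum b ψ K x ^ (1 / p) * W ^ (1 - 1 / p)) := by
          rw [Real.mul_rpow hc₁.le (i0 x)]; ring
      _ ≤ c₁ * (dyadicSum b ψ K x ^ (1 / p) * W ^ (1 - 1 / p)) := by
          refine mul_le_mul_of_nonneg_right ?_
            (mul_nonneg (Real.rpow_nonneg (i0 x) _) (by positivity))
          exact (Real.rpow_le_rpow_of_exponent_le hc₁1 hp1).trans_eq (Real.rpow_one _)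
  · refine (hsize K x).trans (mul_le_mul_of_nonneg_right hA (by positivity))

/-- For integer `σ/3` a single compactly supported profile works and no tail has to be
controlled. -/
theorem exists_isProfile_of_integer (n : ℕ) {k : ℕ} {σ p ρ : ℝ} (hσ : 0 < σ) (hk : σ = 3 * k)
    (hp : 1 < p) (hρ : 0 < ρ) (hρ1 : ρ < 1) :
    ∃ φ : EuclideanSpace ℝ (Fin n) → ℝ, (∀ x, φ x ≤ 1) ∧ (∀ x, ‖x‖ < ρ → φ x = 1) ∧
      (∀ x, 1 ≤ ‖x‖ → φ x = 0) ∧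
      (∀ x, ‖x‖ < ρ → fracLaplacian σ φ x = 0 ∧ fracLaplacian (σ / 3) φ x = 0 ∧
        fracLaplacian (2 * σ / 3) φ x = 0) ∧
      ∃ A > 0, ∀ L, 1 ≤ L →
        IsProfile σ p A ρ L ((Metric.closedBall 0 1).indicator fun _ => 1) (fun _ => 0) φ := by
  obtain ⟨φ, hs, hc, h0, h1, hρφ, hz, hj⟩ := exists_local_profile n (3 * k) hp hρ hρ1
  have hk0 : 0 < k := by
    rcases Nat.eq_zero_or_pos k with h | h
    · simp [h] at hk; linarith
    · exact h
  obtain ⟨⟨A₁, hA₁, h₁⟩, z₁⟩ := hj (3 * k) (by omega) le_rfl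
  obtain ⟨⟨A₂, hA₂, h₂⟩, z₂⟩ := hj k (by omega) (by omega)
  obtain ⟨⟨A₃, hA₃, h₃⟩, z₃⟩ := hj (2 * k) (by omega) (by omega)
  have e₁ : ((3 * k : ℕ) : ℝ) = σ := by rw [hk]; push_cast; ring
  have e₂ : (k : ℝ) = σ / 3 := by rw [hk]; ring
  have e₃ : ((2 * k : ℕ) : ℝ) = 2 * σ / 3 := by rw [hk]; push_cast; ring
  rw [e₁] at h₁ z₁
  rw [e₂] at h₂ z₂
  rw [e₃] at h₃ z₃
  refine ⟨φ, h1, hρφ, hz, fun x hx => ⟨z₁ x hx, z₂ x hx, z₃ x hx⟩,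
    1 + A₁ + A₂ + A₃, by positivity, fun L hL => ?_⟩
  have hp0 : 0 < 1 / p := by positivity
  have hp1 : 1 / p ≤ 1 := by rw [div_le_one (by linarith)]; exact hp.le
  have hsize : ∀ x, profileSize σ φ x ≤ (1 + A₁ + A₂ + A₃) * φ x ^ (1 / p) := by
    intro x
    have h4 : |φ x| ≤ 1 * φ x ^ (1 / p) := by
      rw [abs_of_nonneg (h0 x), one_mul]
      rcases (h0 x).eq_or_lt with h | h
      · rw [← h, Real.zero_rpow hp0.ne']
      · exact (Real.rpow_one _).symm.trans_le (Real.rpow_le_rpow_of_exponent_ge h (h1 x) hp1)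
    simp only [profileSize, add_mul]
    exact add_le_add (add_le_add (add_le_add h4 (h₁ x)) (h₂ x)) (h₃ x)
  have hφ0 : φ 0 = 1 := hρφ 0 (by simpa using hρ)
  refine ⟨hs, hc, h0, hφ0.ge, fun x hx => (hρφ x hx).trans hφ0.symm, fun x => ?_, fun x _ => ?_,
    fun x hx => ?_⟩
  · refine (hsize x).trans (mul_le_of_le_one_right (by positivity) ?_)
    exact Real.rpow_le_one (h0 x) (h1 x) hp0.le
  · rcases le_or_gt ‖x‖ 1 with hx | hx
    · rw [indicator_of_mem (mem_closedBall_zero_iff.2 hx), Real.one_rpow, mul_one]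
      exact hsize x
    · refine (hsize x).trans_eq ?_
      rw [hz x hx.le, Real.zero_rpow hp0.ne', zero_mul]
  · refine (hsize x).trans_eq ?_
    rw [hz x (by linarith), Real.zero_rpow hp0.ne', mul_zero]

/-! ### Scaled product test functions -/

/-- The length scale `S^{3/(2σ)}` that corresponds to the time scale `S`. -/
noncomputable def spaceScale (σ S : ℝ) : ℝ := S ^ (3 / (2 * σ))

/-- The test function `ζ(t/S) φ(x/R)` with `R = S^{3/(2σ)}`. -/
noncomputable def scaledTest {n : ℕ} (σ : ℝ) (ζ : ℝ → ℝ) (φ : EuclideanSpace ℝ (Fin n) → ℝ) (S : ℝ) :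
    ℝ × EuclideanSpace ℝ (Fin n) → ℝ :=
  fun z => ζ (S⁻¹ * z.1) * φ ((spaceScale σ S)⁻¹ • z.2)

lemma spaceScale_pos {σ S : ℝ} (hS : 0 < S) : 0 < spaceScale σ S := Real.rpow_pos_of_pos hS _

lemma spaceScale_rpow_neg {σ S : ℝ} (hσ : 0 < σ) (hS : 0 < S) (k : ℕ) :
    spaceScale σ S ^ (-(2 * (k * σ / 3))) = S⁻¹ ^ k := by
  rw [spaceScale, ← Real.rpow_mul hS.le, inv_pow, ← Real.rpow_natCast, ← Real.rpow_neg hS.le]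
  congr 1
  field_simp

lemma isTestFunction_scaledTest {n : ℕ} {σ p B S T : ℝ} (hS : 0 < S) (hST : S < T)
    {ζ : ℝ → ℝ} (hζ : IsTimeCutoff p B ζ) {φ : EuclideanSpace ℝ (Fin n) → ℝ} (hφ : ContDiff ℝ ∞ φ)
    (hc : HasCompactSupport φ) : IsTestFunction T (scaledTest σ ζ φ S) := by
  have hR := spaceScale_pos (σ := σ) hS
  have hsupp : tsupport (scaledTest σ ζ φ S) ⊆
      Icc (-S) S ×ˢ tsupport (fun x => φ ((spaceScale σ S)⁻¹ • x)) := by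
    refine closure_minimal ?_ (isClosed_Icc.prod (isClosed_tsupport _))
    intro z hz
    have h1 : ζ (S⁻¹ * z.1) ≠ 0 := left_ne_zero_of_mul hz
    have h2 : φ ((spaceScale σ S)⁻¹ • z.2) ≠ 0 := right_ne_zero_of_mul hz
    refine ⟨?_, subset_tsupport (fun x => φ ((spaceScale σ S)⁻¹ • x)) h2⟩
    by_contra h
    refine h1 (hζ.eq_zero _ ?_)
    rw [abs_mul, abs_of_pos (inv_pos.2 hS), ← div_eq_inv_mul, le_div_iff₀ hS, one_mul]
    rw [mem_Icc, ← abs_le, not_le] at h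
    exact h.le
  refine ⟨?_, ?_, ?_⟩
  · have := hζ.smooth
    unfold scaledTest
    fun_prop
  · exact HasCompactSupport.of_support_subset_isCompact
      (isCompact_Icc.prod (hc.comp_smul (inv_ne_zero hR.ne')).isCompact)
      ((subset_tsupport _).trans hsupp)
  · intro z hz
    exact ⟨lt_of_le_of_lt (hsupp hz).1.2 hST, mem_univ _⟩

lemma timeDeriv_scaledTest {n : ℕ} {σ p B : ℝ} (S : ℝ)
    {ζ : ℝ → ℝ} (hζ : IsTimeCutoff p B ζ) (φ : EuclideanSpace ℝ (Fin n) → ℝ) (k : ℕ) (t : ℝ) :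
    timeDeriv k (scaledTest σ ζ φ S) t = fun x => (S⁻¹ ^ k * iteratedDeriv k ζ (S⁻¹ * t)) *
      φ ((spaceScale σ S)⁻¹ • x) := by
  funext x
  simp only [timeDeriv, scaledTest]
  rw [iteratedDeriv_mul_const_field,
    iteratedDeriv_comp_const_smul (hζ.smooth.of_le (mod_cast le_top))]
  rfl

lemma adjointOp_scaledTest {n : ℕ} {σ p B η S : ℝ} (hσ : 0 < σ) (hS : 0 < S)
    {ζ : ℝ → ℝ} (hζ : IsTimeCutoff p B ζ) (φ : EuclideanSpace ℝ (Fin n) → ℝ)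
    (z : ℝ × EuclideanSpace ℝ (Fin n)) :
    adjointOp σ η (scaledTest σ ζ φ S) z = S⁻¹ ^ 3 *
      (-(iteratedDeriv 3 ζ (S⁻¹ * z.1) * φ ((spaceScale σ S)⁻¹ • z.2))
        + ζ (S⁻¹ * z.1) * fracLaplacian σ φ ((spaceScale σ S)⁻¹ • z.2)
        + η * (iteratedDeriv 2 ζ (S⁻¹ * z.1) *
          fracLaplacian (σ / 3) φ ((spaceScale σ S)⁻¹ • z.2))
        - η * (iteratedDeriv 1 ζ (S⁻¹ * z.1) *
          fracLaplacian (2 * σ / 3) φ ((spaceScale σ S)⁻¹ • z.2))) := by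
  have hR := spaceScale_pos (σ := σ) hS
  have e1 := spaceScale_rpow_neg hσ hS 1
  have e2 := spaceScale_rpow_neg hσ hS 2
  have e3 := spaceScale_rpow_neg hσ hS 3
  rw [show 2 * (((1 : ℕ) : ℝ) * σ / 3) = 2 * (σ / 3) by push_cast; ring] at e1
  rw [show 2 * (((2 : ℕ) : ℝ) * σ / 3) = 2 * (2 * σ / 3) by push_cast; ring] at e2
  rw [show 2 * (((3 : ℕ) : ℝ) * σ / 3) = 2 * σ by push_cast; ring] at e3
  simp only [adjointOp, timeDeriv_scaledTest S hζ]
  rw [fracLaplacian_const_mul_comp_inv_smul _ _ _ hR, fracLaplacian_const_mul_comp_inv_smul _ _ _ hR,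
    fracLaplacian_const_mul_comp_inv_smul _ _ _ hR, e1, e2, e3, iteratedDeriv_zero]
  ring

lemma dataTerm_scaledTest {n : ℕ} {σ p B η S : ℝ} (hσ : 0 < σ) (hS : 0 < S)
    {ζ : ℝ → ℝ} (hζ : IsTimeCutoff p B ζ) (φ u₀ u₁ u₂ : EuclideanSpace ℝ (Fin n) → ℝ)
    (x : EuclideanSpace ℝ (Fin n)) :
    dataTerm σ η u₀ u₁ u₂ (scaledTest σ ζ φ S) x = u₂ x * φ ((spaceScale σ S)⁻¹ • x)
      + η * S⁻¹ * (u₁ x * fracLaplacian (σ / 3) φ ((spaceScale σ S)⁻¹ • x))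
      + η * S⁻¹ ^ 2 * (u₀ x * fracLaplacian (2 * σ / 3) φ ((spaceScale σ S)⁻¹ • x)) := by
  have hR := spaceScale_pos (σ := σ) hS
  have e1 := spaceScale_rpow_neg hσ hS 1
  have e2 := spaceScale_rpow_neg hσ hS 2
  rw [show 2 * (((1 : ℕ) : ℝ) * σ / 3) = 2 * (σ / 3) by push_cast; ring] at e1
  rw [show 2 * (((2 : ℕ) : ℝ) * σ / 3) = 2 * (2 * σ / 3) by push_cast; ring] at e2
  have d0 : ζ 0 = 1 := hζ.eq_one 0 (by simp)
  have d1 : iteratedDeriv 1 ζ 0 = 0 := hζ.deriv_eq_zero 0 (by simp) 1 one_pos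
  have d2 : iteratedDeriv 2 ζ 0 = 0 := hζ.deriv_eq_zero 0 (by simp) 2 two_pos
  simp only [dataTerm, timeDeriv_scaledTest S hζ]
  rw [fracLaplacian_const_mul_comp_inv_smul _ _ _ hR, fracLaplacian_const_mul_comp_inv_smul _ _ _ hR,
    fracLaplacian_const_mul_comp_inv_smul _ _ _ hR, e1, e2, iteratedDeriv_zero, mul_zero, d0, d1, d2]
  ring

lemma abs_adjointOp_scaledTest_le {n : ℕ} {σ p B η S : ℝ} (hσ : 0 < σ) (hη : 0 < η) (hS : 0 < S)
    {ζ : ℝ → ℝ} (hζ : IsTimeCutoff p B ζ) (φ : EuclideanSpace ℝ (Fin n) → ℝ)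
    (z : ℝ × EuclideanSpace ℝ (Fin n)) :
    |adjointOp σ η (scaledTest σ ζ φ S) z| ≤ (1 + η) * B * S⁻¹ ^ 3 *
      (ζ (S⁻¹ * z.1) ^ (1 / p) * profileSize σ φ ((spaceScale σ S)⁻¹ • z.2)) := by
  rw [adjointOp_scaledTest hσ hS hζ, abs_mul, abs_of_nonneg (by positivity : (0 : ℝ) ≤ S⁻¹ ^ 3)]
  set τ := S⁻¹ * z.1
  set y := (spaceScale σ S)⁻¹ • z.2
  have hd0 := hζ.deriv_le 0 (by norm_num) τ
  have hd1 := hζ.deriv_le 1 (by norm_num) τ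
  have hd2 := hζ.deriv_le 2 (by norm_num) τ
  have hd3 := hζ.deriv_le 3 (by norm_num) τ
  rw [iteratedDeriv_zero] at hd0
  set Z := B * ζ τ ^ (1 / p)
  have hZ : 0 ≤ Z := (abs_nonneg _).trans hd0
  have key : |-(iteratedDeriv 3 ζ τ * φ y) + ζ τ * fracLaplacian σ φ y
      + η * (iteratedDeriv 2 ζ τ * fracLaplacian (σ / 3) φ y)
      - η * (iteratedDeriv 1 ζ τ * fracLaplacian (2 * σ / 3) φ y)|
      ≤ (1 + η) * (Z * profileSize σ φ y) := by
    refine (abs_sub _ _).trans ?_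
    refine (add_le_add_left ((abs_add_le _ _).trans
      (add_le_add_left (abs_add_le _ _) _)) _).trans ?_
    simp only [abs_neg, abs_mul, abs_of_pos hη]
    have b3 := mul_le_mul_of_nonneg_right hd3 (abs_nonneg (φ y))
    have b0 := mul_le_mul_of_nonneg_right hd0 (abs_nonneg (fracLaplacian σ φ y))
    have b2 := mul_le_mul_of_nonneg_right hd2 (abs_nonneg (fracLaplacian (σ / 3) φ y))
    have b1 := mul_le_mul_of_nonneg_right hd1 (abs_nonneg (fracLaplacian (2 * σ / 3) φ y))
    have c2 := mul_le_mul_of_nonneg_left b2 hη.le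
    have c1 := mul_le_mul_of_nonneg_left b1 hη.le
    have n3 := mul_nonneg hη.le (mul_nonneg hZ (abs_nonneg (φ y)))
    have n0 := mul_nonneg hη.le (mul_nonneg hZ (abs_nonneg (fracLaplacian σ φ y)))
    have n2 := mul_nonneg hZ (abs_nonneg (fracLaplacian (σ / 3) φ y))
    have n1 := mul_nonneg hZ (abs_nonneg (fracLaplacian (2 * σ / 3) φ y))
    simp only [profileSize]
    linarith
  calc S⁻¹ ^ 3 * _ ≤ S⁻¹ ^ 3 * ((1 + η) * (Z * profileSize σ φ y)) := by gcongr
    _ = _ := by ring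

/-! ### The initial data -/

lemma tendsto_setIntegral_norm_superlevel {X : Type*} [MeasurableSpace X] {μ : Measure X}
    {N f : X → ℝ} (hN : Measurable N) (hf : Integrable f μ) :
    Tendsto (fun r => ∫ x in {x | r ≤ N x}, |f x| ∂μ) atTop (𝓝 0) := by
  have hm : ∀ r, MeasurableSet {x | r ≤ N x} := fun r => measurableSet_le measurable_const hN
  simp_rw [← integral_indicator (hm _)]
  rw [← integral_zero X ℝ (μ := μ)]
  refine tendsto_integral_filter_of_dominated_convergence (fun x => |f x|)
    (Eventually.of_forall fun r => (hf.abs.indicator (hm r)).aestronglyMeasurable)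
    (Eventually.of_forall fun r => ae_of_all _ fun x => ?_) hf.abs (ae_of_all _ fun x => ?_)
  · rw [Real.norm_eq_abs, indicator_apply]
    split_ifs <;> simp
  · refine tendsto_const_nhds.congr' ?_
    filter_upwards [eventually_gt_atTop (N x)] with r hr
    rw [indicator_of_notMem]
    simpa using hr

lemma tendsto_spaceScale {σ : ℝ} (hσ : 0 < σ) : Tendsto (spaceScale σ) atTop atTop :=
  tendsto_rpow_atTop (by positivity)

lemma IsProfile.abs_le {n : ℕ} {σ p A ρ L : ℝ} {w v φ : EuclideanSpace ℝ (Fin n) → ℝ}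
    (h : IsProfile σ p A ρ L w v φ) (x : EuclideanSpace ℝ (Fin n)) :
    |φ x| ≤ A ∧ |fracLaplacian (σ / 3) φ x| ≤ A ∧ |fracLaplacian (2 * σ / 3) φ x| ≤ A := by
  have h1 := h.size_le x
  simp only [profileSize] at h1
  have := abs_nonneg (φ x)
  have := abs_nonneg (fracLaplacian σ φ x)
  have := abs_nonneg (fracLaplacian (σ / 3) φ x)
  have := abs_nonneg (fracLaplacian (2 * σ / 3) φ x)
  refine ⟨by linarith, by linarith, by linarith⟩

lemma abs_integral_mul_le {X : Type*} [MeasurableSpace X] {μ : Measure X} {f g : X → ℝ} {A : ℝ}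
    (hf : Integrable f μ) (hg : ∀ x, |g x| ≤ A) :
    |∫ x, f x * g x ∂μ| ≤ A * ∫ x, |f x| ∂μ := by
  rw [← integral_const_mul, ← Real.norm_eq_abs]
  refine norm_integral_le_of_norm_le (hf.abs.const_mul A) (ae_of_all _ fun x => ?_)
  rw [norm_mul, mul_comm]
  exact mul_le_mul_of_nonneg_right (hg x) (abs_nonneg _)

/-- At large scales the data term of a scaled profile is at least half the mass of `u₂`, uniformly
over the profiles. -/
lemma exists_half_le_integral_dataTerm {n : ℕ} {σ η p A B ρ m : ℝ} (hσ : 0 < σ) (hη : 0 < η)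
    (hρ : 0 < ρ) (hm : 0 < m) {u₀ u₁ u₂ : EuclideanSpace ℝ (Fin n) → ℝ}
    (h₀ : Integrable u₀) (h₁ : Integrable u₁) (h₂ : Integrable u₂) (hmass : ∫ x, u₂ x = m) :
    ∃ S₀ > 0, ∀ S, S₀ ≤ S → ∀ ζ, IsTimeCutoff p B ζ → ∀ L w v φ, IsProfile σ p A ρ L w v φ →
      m / 2 ≤ ∫ x, dataTerm σ η u₀ u₁ u₂ (scaledTest σ ζ φ S) x := by
  set g : ℝ → ℝ := fun S => 2 * A * (∫ x in {x | ρ * spaceScale σ S ≤ ‖x‖}, |u₂ x|)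
    + η * S⁻¹ * (A * ∫ x, |u₁ x|) + η * S⁻¹ ^ 2 * (A * ∫ x, |u₀ x|) with hg
  have hlim : Tendsto g atTop (𝓝 0) := by
    have l1 := (tendsto_setIntegral_norm_superlevel measurable_norm h₂).comp
      ((tendsto_spaceScale hσ).const_mul_atTop hρ)
    have l2 := tendsto_inv_atTop_zero (𝕜 := ℝ)
    have l3 := ((l1.const_mul (2 * A)).add ((l2.const_mul η).mul_const (A * ∫ x, |u₁ x|))).add
      (((l2.pow 2).const_mul η).mul_const (A * ∫ x, |u₀ x|))
    simpa [hg, Function.comp_def] using l3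
  obtain ⟨S₀, hS₀⟩ := eventually_atTop.1 (hlim.eventually (gt_mem_nhds (half_pos hm)))
  refine ⟨max S₀ 1, by positivity, fun S hSS ζ hζ L w v φ hφ => ?_⟩
  have hS : 0 < S := lt_of_lt_of_le (by positivity) hSS
  have hgS := hS₀ S ((le_max_left _ _).trans hSS)
  have hR := spaceScale_pos (σ := σ) hS
  have hcont : Continuous fun x : EuclideanSpace ℝ (Fin n) => (spaceScale σ S)⁻¹ • x := by
    fun_prop
  have c1 := ((continuous_fracLaplacian (s := σ / 3) (by positivity) hφ.smooth hφ.compact).comp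
    hcont).aestronglyMeasurable (μ := volume)
  have c2 := ((continuous_fracLaplacian (s := 2 * σ / 3) (by positivity) hφ.smooth hφ.compact).comp
    hcont).aestronglyMeasurable (μ := volume)
  have c3 := (hφ.smooth.continuous.comp hcont).aestronglyMeasurable (μ := volume)
  have hB := hφ.abs_le
  have i2 : Integrable fun x => u₂ x * φ ((spaceScale σ S)⁻¹ • x) :=
    h₂.mul_bdd c3 (ae_of_all _ fun x => (hB _).1)
  have i1 : Integrable fun x => u₁ x * fracLaplacian (σ / 3) φ ((spaceScale σ S)⁻¹ • x) :=
    h₁.mul_bdd c1 (ae_of_all _ fun x => (hB _).2.1)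
  have i0 : Integrable fun x => u₀ x * fracLaplacian (2 * σ / 3) φ ((spaceScale σ S)⁻¹ • x) :=
    h₀.mul_bdd c2 (ae_of_all _ fun x => (hB _).2.2)
  have b1 := abs_integral_mul_le h₁ fun x => (hB ((spaceScale σ S)⁻¹ • x)).2.1
  have b0 := abs_integral_mul_le h₀ fun x => (hB ((spaceScale σ S)⁻¹ • x)).2.2
  have hms : MeasurableSet {x : EuclideanSpace ℝ (Fin n) | ρ * spaceScale σ S ≤ ‖x‖} :=
    measurableSet_le measurable_const measurable_norm
  have b2 : |(∫ x, u₂ x * φ ((spaceScale σ S)⁻¹ • x)) - m * φ 0|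
      ≤ 2 * A * (∫ x in {x | ρ * spaceScale σ S ≤ ‖x‖}, |u₂ x|) := by
    rw [← hmass, ← integral_mul_const, ← integral_sub i2 (h₂.mul_const _), ← integral_const_mul,
      ← integral_indicator hms, ← Real.norm_eq_abs]
    refine norm_integral_le_of_norm_le ((h₂.abs.const_mul (2 * A)).indicator hms)
      (ae_of_all _ fun x => ?_)
    rw [← mul_sub, norm_mul, Real.norm_eq_abs, Real.norm_eq_abs, indicator_apply]
    split_ifs with hx
    · rw [mul_comm]
      refine mul_le_mul_of_nonneg_right ((abs_sub _ _).trans ?_) (abs_nonneg _)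
      linarith [(hB ((spaceScale σ S)⁻¹ • x)).1, (hB 0).1]
    · rw [mem_ofPred_eq, not_le] at hx
      rw [hφ.eq_of_lt, sub_self, abs_zero, mul_zero]
      rw [norm_smul, norm_inv, Real.norm_of_nonneg hR.le, ← div_eq_inv_mul, div_lt_iff₀ hR]
      exact hx
  have hint : ∫ x, dataTerm σ η u₀ u₁ u₂ (scaledTest σ ζ φ S) x
      = (∫ x, u₂ x * φ ((spaceScale σ S)⁻¹ • x))
        + η * S⁻¹ * (∫ x, u₁ x * fracLaplacian (σ / 3) φ ((spaceScale σ S)⁻¹ • x))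
        + η * S⁻¹ ^ 2 * ∫ x, u₀ x * fracLaplacian (2 * σ / 3) φ ((spaceScale σ S)⁻¹ • x) := by
    simp_rw [dataTerm_scaledTest hσ hS hζ]
    have i12 : Integrable fun x => u₂ x * φ ((spaceScale σ S)⁻¹ • x)
        + η * S⁻¹ * (u₁ x * fracLaplacian (σ / 3) φ ((spaceScale σ S)⁻¹ • x)) :=
      i2.add (i1.const_mul _)
    rw [integral_add i12 (i0.const_mul _), integral_add i2 (i1.const_mul _),
      integral_const_mul, integral_const_mul]
  rw [hint]
  have k1 := mul_le_mul_of_nonneg_left (abs_le.1 b1).1 (by positivity : 0 ≤ η * S⁻¹)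
  have k0 := mul_le_mul_of_nonneg_left (abs_le.1 b0).1 (by positivity : 0 ≤ η * S⁻¹ ^ 2)
  have k2 := (abs_le.1 b2).1
  have k3 : m ≤ m * φ 0 := le_mul_of_one_le_right hm.le hφ.one_le
  simp only [hg] at hgS
  linarith

/-! ### The test function inequality -/

lemma prod_restrict_Ioo {n : ℕ} (S : ℝ) :
    (volume : Measure (ℝ × EuclideanSpace ℝ (Fin n))).restrict (Ioo 0 S ×ˢ univ)
      = (volume.restrict (Ioo 0 S)).prod volume := by
  rw [Measure.volume_eq_prod, ← Measure.prod_restrict, Measure.restrict_univ]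

lemma integrable_strip {n : ℕ} {w : EuclideanSpace ℝ (Fin n) → ℝ} (hw : Integrable w) {R : ℝ}
    (hR : 0 < R) (S : ℝ) :
    Integrable (fun z : ℝ × EuclideanSpace ℝ (Fin n) => w (R⁻¹ • z.2))
      (volume.restrict (Ioo 0 S ×ˢ univ)) := by
  rw [prod_restrict_Ioo]
  have h : Integrable fun x => w (R⁻¹ • x) :=
    (integrable_comp_smul_iff volume w (inv_ne_zero hR.ne')).2 hw
  exact h.comp_snd (volume.restrict (Ioo 0 S))

lemma integral_strip {n : ℕ} (w : EuclideanSpace ℝ (Fin n) → ℝ) {R : ℝ}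
    (hR : 0 < R) {S : ℝ} (hS : 0 < S) :
    ∫ z : ℝ × EuclideanSpace ℝ (Fin n) in Ioo 0 S ×ˢ univ, w (R⁻¹ • z.2)
      = S * (R ^ n * ∫ x, w x) := by
  rw [prod_restrict_Ioo, integral_fun_snd (fun x => w (R⁻¹ • x)), Measure.integral_comp_inv_smul,
    finrank_euclideanSpace, Fintype.card_fin, abs_of_pos (by positivity)]
  simp [Measure.real, Real.volume_Ioo, hS.le]

lemma IsTimeCutoff.eq_zero_of_le {p B S t : ℝ} {ζ : ℝ → ℝ} (hζ : IsTimeCutoff p B ζ) (hS : 0 < S)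
    (hz : S ≤ t) : ζ (S⁻¹ * t) = 0 := by
  refine hζ.eq_zero _ (le_trans ?_ (le_abs_self _))
  rw [← div_eq_inv_mul, le_div_iff₀ hS, one_mul]
  exact hz

lemma le_of_mem_strip_diff {n : ℕ} {S T : ℝ} {z : ℝ × EuclideanSpace ℝ (Fin n)}
    (hz : z ∈ (Ioo 0 T ×ˢ univ : Set (ℝ × EuclideanSpace ℝ (Fin n))) \ (Ioo 0 S ×ˢ univ)) :
    S ≤ z.1 := by
  by_contra h
  exact hz.2 ⟨⟨hz.1.1.1, not_le.1 h⟩, mem_univ _⟩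

lemma strip_subset {n : ℕ} {S T : ℝ} (h : S ≤ T) :
    (Ioo 0 S ×ˢ univ : Set (ℝ × EuclideanSpace ℝ (Fin n))) ⊆ Ioo 0 T ×ˢ univ :=
  prod_mono (Ioo_subset_Ioo_right h) le_rfl

lemma measurableSet_strip {n : ℕ} (S : ℝ) :
    MeasurableSet (Ioo 0 S ×ˢ univ : Set (ℝ × EuclideanSpace ℝ (Fin n))) :=
  measurableSet_Ioo.prod MeasurableSet.univ

lemma IsWeakSolution.integrableOn_rpow_mul {n : ℕ} {σ η p ε S T : ℝ}
    {u₀ u₁ u₂ : EuclideanSpace ℝ (Fin n) → ℝ} {u : ℝ × EuclideanSpace ℝ (Fin n) → ℝ}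
    (hu : IsWeakSolution σ η p ε u₀ u₁ u₂ T u) (hS : 0 < S) (hST : S < T) {B : ℝ} {ζ : ℝ → ℝ}
    (hζ : IsTimeCutoff p B ζ) {φ : EuclideanSpace ℝ (Fin n) → ℝ} (hφ : ContDiff ℝ ∞ φ)
    (hc : HasCompactSupport φ) :
    IntegrableOn (fun z => |u z| ^ p * scaledTest σ ζ φ S z) (Ioo 0 T ×ˢ univ) := by
  have hR := spaceScale_pos (σ := σ) hS
  have ht := isTestFunction_scaledTest (σ := σ) hS hST hζ hφ hc
  obtain ⟨r, hr⟩ := (hc.comp_smul (inv_ne_zero hR.ne')).isCompact.isBounded.subset_ball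
    (0 : EuclideanSpace ℝ (Fin n))
  obtain ⟨C, hC⟩ := ht.compact.exists_bound_of_continuous ht.smooth.continuous
  have h1 : IntegrableOn (fun z => |u z| ^ p * scaledTest σ ζ φ S z)
      (Ioo 0 S ×ˢ Metric.ball 0 r) :=
    (hu.locally_integrable S hST r).mul_bdd
      ht.smooth.continuous.aestronglyMeasurable (ae_of_all _ hC)
  refine h1.of_forall_sdiff_eq_zero (measurableSet_strip T) fun z hz => ?_
  rcases le_or_gt S z.1 with h | h
  · simp [scaledTest, hζ.eq_zero_of_le hS h]
  · have : φ ((spaceScale σ S)⁻¹ • z.2) = 0 := by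
      by_contra h2
      exact hz.2 ⟨⟨hz.1.1.1, h⟩, hr (subset_tsupport (fun x => φ ((spaceScale σ S)⁻¹ • x)) h2)⟩
    simp [scaledTest, this]

lemma scaledTest_nonneg {n : ℕ} {σ p B S : ℝ} {ζ : ℝ → ℝ} (hζ : IsTimeCutoff p B ζ)
    {φ : EuclideanSpace ℝ (Fin n) → ℝ} (hφ : ∀ x, 0 ≤ φ x) (z : ℝ × EuclideanSpace ℝ (Fin n)) :
    0 ≤ scaledTest σ ζ φ S z :=
  mul_nonneg (hζ.nonneg _) (hφ _)

/-- Testing the equation with a scaled profile. On the set `D` where the adjoint operator acts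
nontrivially Hölder's inequality applies near the origin; what is left is an integral of `|u|`
over the tail. -/
theorem IsWeakSolution.test_inequality {n : ℕ} {σ η p ε S T A B ρ L : ℝ}
    {u₀ u₁ u₂ : EuclideanSpace ℝ (Fin n) → ℝ} {u : ℝ × EuclideanSpace ℝ (Fin n) → ℝ}
    (hu : IsWeakSolution σ η p ε u₀ u₁ u₂ T u) (hσ : 0 < σ) (hη : 0 < η) (hp : 1 < p)
    (hS : 0 < S) (hST : S < T) (hA : 0 < A) (hB : 0 < B) {ζ : ℝ → ℝ} (hζ : IsTimeCutoff p B ζ)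
    {w v φ : EuclideanSpace ℝ (Fin n) → ℝ} (hφ : IsProfile σ p A ρ L w v φ)
    (hw : Integrable w) (hw0 : ∀ x, 0 ≤ w x) (hv0 : ∀ x, 0 ≤ v x)
    (hv : IntegrableOn (fun z => |u z| * v ((spaceScale σ S)⁻¹ • z.2)) (Ioo 0 S ×ˢ univ))
    {D : Set (ℝ × EuclideanSpace ℝ (Fin n))} (hD : MeasurableSet D)
    (hDz : ∀ z, 0 < z.1 → z ∉ D → adjointOp σ η (scaledTest σ ζ φ S) z = 0) :
    ε * (∫ x, dataTerm σ η u₀ u₁ u₂ (scaledTest σ ζ φ S) x)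
        + ∫ z in Ioo 0 T ×ˢ univ, |u z| ^ p * scaledTest σ ζ φ S z
      ≤ (1 + η) * B * A * S⁻¹ ^ 3 *
        ((∫ z in Ioo 0 T ×ˢ univ, D.indicator (fun z => |u z| ^ p * scaledTest σ ζ φ S z) z)
            ^ (1 / p) * (S * (spaceScale σ S ^ n * ∫ x, w x)) ^ (1 - 1 / p)
          + ∫ z in Ioo 0 S ×ˢ univ, {z | L ≤ ‖(spaceScale σ S)⁻¹ • z.2‖}.indicator
            (fun z => |u z| * v ((spaceScale σ S)⁻¹ • z.2)) z) := by
  have hR := spaceScale_pos (σ := σ) hS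
  have hp0 : 0 < p := by linarith
  have ht := isTestFunction_scaledTest (σ := σ) hS hST hζ hφ.smooth hφ.compact
  set Φ := scaledTest σ ζ φ S with hΦ
  set R := spaceScale σ S
  have hΦ0 : ∀ z, 0 ≤ Φ z := scaledTest_nonneg hζ hφ.nonneg
  have hpq : p.HolderConjugate (p / (p - 1)) := Real.HolderConjugate.conjExponent hp
  set q := p / (p - 1)
  have hq : 1 - 1 / p = 1 / q := by
    have : p - 1 ≠ 0 := by linarith
    simp only [q]
    field_simp
  have hq0 : 0 < q := hpq.symm.pos
  have hXint := hu.integrableOn_rpow_mul hS hST hζ hφ.smooth hφ.compact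
  set μ := (volume : Measure (ℝ × EuclideanSpace ℝ (Fin n))).restrict (Ioo 0 S ×ˢ univ) with hμ
  -- beyond the time `S` everything vanishes
  have hcut : ∀ z : ℝ × EuclideanSpace ℝ (Fin n), S ≤ z.1 → ζ (S⁻¹ * z.1) = 0 :=
    fun z hz => hζ.eq_zero_of_le hS hz
  have hadj := abs_adjointOp_scaledTest_le (η := η) hσ hη hS hζ φ
  have hadj0 : ∀ z ∈ (Ioo 0 T ×ˢ univ : Set (ℝ × EuclideanSpace ℝ (Fin n))) \ (Ioo 0 S ×ˢ univ),
      u z * adjointOp σ η Φ z = 0 := by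
    intro z hz
    have h1 := hadj z
    rw [hcut z (le_of_mem_strip_diff hz), Real.zero_rpow (by positivity), zero_mul, mul_zero] at h1
    rw [abs_nonpos_iff.1 h1, mul_zero]
  have hDcut : ∀ z ∈ (Ioo 0 T ×ˢ univ : Set (ℝ × EuclideanSpace ℝ (Fin n))) \ (Ioo 0 S ×ˢ univ),
      D.indicator (fun z => |u z| ^ p * Φ z) z = 0 := by
    intro z hz
    have : Φ z = 0 := by rw [hΦ, scaledTest, hcut z (le_of_mem_strip_diff hz), zero_mul]
    simp [this]
  have hI1 : ∫ z in Ioo 0 T ×ˢ univ, u z * adjointOp σ η Φ z = ∫ z, u z * adjointOp σ η Φ z ∂μ :=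
    (setIntegral_eq_of_subset_of_forall_sdiff_eq_zero (measurableSet_strip T)
      (strip_subset hST.le) hadj0)
  have hI2 : ∫ z in Ioo 0 T ×ˢ univ, D.indicator (fun z => |u z| ^ p * Φ z) z
      = ∫ z, D.indicator (fun z => |u z| ^ p * Φ z) z ∂μ :=
    (setIntegral_eq_of_subset_of_forall_sdiff_eq_zero (measurableSet_strip T)
      (strip_subset hST.le) hDcut)
  rw [hu.weak_eq Φ ht, hI1, hI2]
  have hum : AEStronglyMeasurable u μ := hu.measurable.mono_measure
    (Measure.restrict_mono (strip_subset hST.le) le_rfl)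
  -- the two factors in Hölder's inequality
  set F : ℝ × EuclideanSpace ℝ (Fin n) → ℝ := D.indicator fun z => |u z| * Φ z ^ (1 / p) with hF
  set G : ℝ × EuclideanSpace ℝ (Fin n) → ℝ := fun z => w (R⁻¹ • z.2) ^ (1 / q) with hG
  have hF0 : ∀ z, 0 ≤ F z := fun z => indicator_nonneg
    (fun z _ => mul_nonneg (abs_nonneg _) (Real.rpow_nonneg (hΦ0 z) _)) z
  have hG0 : ∀ z, 0 ≤ G z := fun z => Real.rpow_nonneg (hw0 _) _
  have hFp : ∀ z, F z ^ p = D.indicator (fun z => |u z| ^ p * Φ z) z := by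
    intro z
    by_cases hz : z ∈ D
    · rw [hF, indicator_of_mem hz, indicator_of_mem hz, Real.mul_rpow (abs_nonneg _) (Real.rpow_nonneg (hΦ0 z) _), ← Real.rpow_mul (hΦ0 z),
        one_div_mul_cancel hp0.ne', Real.rpow_one]
    · rw [hF, indicator_of_notMem hz, indicator_of_notMem hz, Real.zero_rpow hp0.ne']
  have hGq : ∀ z, G z ^ q = w (R⁻¹ • z.2) := by
    intro z
    simp only [hG]
    rw [← Real.rpow_mul (hw0 _), one_div_mul_cancel hq0.ne', Real.rpow_one]
  have hFm : AEStronglyMeasurable F μ := by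
    refine AEStronglyMeasurable.indicator ?_ hD
    refine hum.norm.mul (Continuous.aestronglyMeasurable ?_)
    exact ht.smooth.continuous.rpow_const fun _ => Or.inr (by positivity)
  have hwint := integrable_strip hw hR S
  have hGm : AEStronglyMeasurable G μ :=
    (hwint.aestronglyMeasurable.aemeasurable.pow_const _).aestronglyMeasurable
  have hFL : MemLp F (ENNReal.ofReal p) μ := by
    rw [← integrable_norm_rpow_iff hFm (by simpa using hp0) ENNReal.ofReal_ne_top,
      ENNReal.toReal_ofReal hp0.le]
    have : (fun z => ‖F z‖ ^ p) = D.indicator fun z => |u z| ^ p * Φ z := by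
      funext z
      rw [Real.norm_of_nonneg (hF0 z), hFp]
    rw [this]
    exact (hXint.mono_set (strip_subset hST.le)).integrable.indicator hD
  have hGL : MemLp G (ENNReal.ofReal q) μ := by
    rw [← integrable_norm_rpow_iff hGm (by simpa using hq0) ENNReal.ofReal_ne_top,
      ENNReal.toReal_ofReal hq0.le]
    have : (fun z => ‖G z‖ ^ q) = fun z : ℝ × EuclideanSpace ℝ (Fin n) => w (R⁻¹ • z.2) := by
      funext z
      rw [Real.norm_of_nonneg (hG0 z), hGq]
    rw [this]
    exact hwint
  have hHolder := integral_mul_le_Lp_mul_Lq_of_nonneg hpq (ae_of_all _ hF0) (ae_of_all _ hG0)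
    hFL hGL
  simp_rw [hFp, hGq] at hHolder
  rw [hμ, integral_strip w hR hS, ← hμ] at hHolder
  have hFG : Integrable (fun z => F z * G z) μ := by
    have : ENNReal.HolderTriple (ENNReal.ofReal p) (ENNReal.ofReal q) 1 :=
      ⟨by simpa using hpq.inv_add_inv_ennreal⟩
    exact hFL.integrable_mul hGL
  have hLm : MeasurableSet {z : ℝ × EuclideanSpace ℝ (Fin n) | L ≤ ‖R⁻¹ • z.2‖} :=
    measurableSet_le measurable_const (by fun_prop)
  set H : ℝ × EuclideanSpace ℝ (Fin n) → ℝ := {z | L ≤ ‖R⁻¹ • z.2‖}.indicator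
    (fun z => |u z| * v (R⁻¹ • z.2)) with hH
  have hH0 : ∀ z, 0 ≤ H z := fun z => indicator_nonneg
    (fun z _ => mul_nonneg (abs_nonneg _) (hv0 _)) z
  have hHint : Integrable H μ := Integrable.indicator hv hLm
  set Kc := (1 + η) * B * A * S⁻¹ ^ 3 with hKc
  have hKc0 : 0 ≤ Kc := by positivity
  have hpt : ∀ z ∈ (Ioo 0 S ×ˢ univ : Set (ℝ × EuclideanSpace ℝ (Fin n))),
      ‖u z * adjointOp σ η Φ z‖ ≤ Kc * (F z * G z + H z) := by
    intro z hz
    have hnn : 0 ≤ F z * G z + H z := add_nonneg (mul_nonneg (hF0 z) (hG0 z)) (hH0 z)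
    by_cases hzD : z ∈ D
    swap
    · rw [hDz z hz.1.1 hzD, mul_zero, norm_zero]
      positivity
    set y := R⁻¹ • z.2 with hy
    set τ := ζ (S⁻¹ * z.1) with hτ
    have hτ0 : 0 ≤ τ := hζ.nonneg _
    rw [norm_mul, Real.norm_eq_abs, Real.norm_eq_abs]
    rcases le_or_gt ‖y‖ L with hL | hL
    · have hFG' : F z * G z = |u z| * (τ ^ (1 / p) * (φ y ^ (1 / p) * w y ^ (1 - 1 / p))) := by
        rw [hF, indicator_of_mem hzD, hG, hq, hΦ]
        simp only [scaledTest]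
        rw [Real.mul_rpow (hζ.nonneg _) (hφ.nonneg _)]
        ring
      calc |u z| * |adjointOp σ η Φ z|
          ≤ |u z| * ((1 + η) * B * S⁻¹ ^ 3 * (τ ^ (1 / p) *
            (A * (φ y ^ (1 / p) * w y ^ (1 - 1 / p))))) := by
            refine mul_le_mul_of_nonneg_left ((hadj z).trans ?_) (abs_nonneg _)
            refine mul_le_mul_of_nonneg_left ?_ (by positivity)
            exact mul_le_mul_of_nonneg_left (hφ.size_inner y hL) (by positivity)
        _ = Kc * (F z * G z) := by rw [hFG', hKc]; ring
        _ ≤ Kc * (F z * G z + H z) := by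
            refine mul_le_mul_of_nonneg_left ?_ hKc0
            linarith [hH0 z]
    · have hHz : H z = |u z| * v y := by
        rw [hH, indicator_of_mem]
        exact hL.le
      have hτ1 : τ ^ (1 / p) ≤ 1 := Real.rpow_le_one hτ0 (hζ.le_one _) (by positivity)
      calc |u z| * |adjointOp σ η Φ z|
          ≤ |u z| * ((1 + η) * B * S⁻¹ ^ 3 * (1 * (A * v y))) := by
            refine mul_le_mul_of_nonneg_left ((hadj z).trans ?_) (abs_nonneg _)
            refine mul_le_mul_of_nonneg_left ?_ (by positivity)
            exact mul_le_mul hτ1 (hφ.size_outer y hL) (profileSize_nonneg _ _ _) zero_le_one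
        _ = Kc * H z := by rw [hHz, hKc]; ring
        _ ≤ Kc * (F z * G z + H z) := by
            refine mul_le_mul_of_nonneg_left ?_ hKc0
            linarith [mul_nonneg (hF0 z) (hG0 z)]
  calc ∫ z, u z * adjointOp σ η Φ z ∂μ ≤ ‖∫ z, u z * adjointOp σ η Φ z ∂μ‖ := le_abs_self _
    _ ≤ ∫ z, Kc * (F z * G z + H z) ∂μ :=
        norm_integral_le_of_norm_le ((hFG.add hHint).const_mul Kc)
          ((ae_restrict_iff' (measurableSet_strip S)).2 (ae_of_all _ hpt))
    _ = Kc * (∫ z, F z * G z ∂μ + ∫ z, H z ∂μ) := by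
        rw [integral_const_mul, integral_add hFG hHint]
    _ ≤ _ := by
        rw [hq]
        gcongr

/-! ### The subcritical lifespan -/

/-- The `S`-dependence of the constant produced by Hölder's inequality. -/
lemma scale_identity {σ S W : ℝ} (hS : 0 < S) (hW : 0 ≤ W) (n : ℕ) (r : ℝ) :
    S⁻¹ ^ 3 * (S * (spaceScale σ S ^ n * W)) ^ r
      = W ^ r * S ^ (-(3 - (1 + 3 * n / (2 * σ)) * r)) := by
  have h1 : S * (spaceScale σ S ^ n * W) = S ^ (1 + 3 * n / (2 * σ)) * W := by
    rw [spaceScale, ← Real.rpow_natCast, ← Real.rpow_mul hS.le, Real.rpow_add hS, Real.rpow_one,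
      show 3 / (2 * σ) * (n : ℝ) = 3 * n / (2 * σ) by ring]
    ring
  have h2 : S⁻¹ ^ 3 = S ^ (-3 : ℝ) := by
    rw [Real.rpow_neg hS.le, inv_pow]
    norm_cast
  rw [h1, h2, Real.mul_rpow (by positivity) hW, ← Real.rpow_mul hS.le, neg_sub, sub_eq_add_neg,
    add_comm, Real.rpow_add hS]
  ring

lemma tail_indicator_tendsto {n : ℕ} {R S : ℝ} {v : EuclideanSpace ℝ (Fin n) → ℝ}
    {u : ℝ × EuclideanSpace ℝ (Fin n) → ℝ} (hv0 : ∀ x, 0 ≤ v x)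
    (hv : IntegrableOn (fun z => |u z| * v (R⁻¹ • z.2)) (Ioo 0 S ×ˢ univ)) :
    Tendsto (fun L => ∫ z in Ioo 0 S ×ˢ univ, {z | L ≤ ‖R⁻¹ • z.2‖}.indicator
      (fun z => |u z| * v (R⁻¹ • z.2)) z) atTop (𝓝 0) := by
  have hN : Measurable fun z : ℝ × EuclideanSpace ℝ (Fin n) => ‖R⁻¹ • z.2‖ := by fun_prop
  refine (tendsto_setIntegral_norm_superlevel hN hv).congr fun L => ?_
  rw [← integral_indicator (measurableSet_le measurable_const hN)]
  congr 1
  funext z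
  congr 1
  funext z
  exact abs_of_nonneg (mul_nonneg (abs_nonneg _) (hv0 _))

/-- The subcritical lifespan bound, from a family of profiles whose tails can be neglected for
every weak solution. -/
theorem lifespan_le_of_profiles {n : ℕ} {σ η p m A ρ : ℝ} (hσ : 0 < σ) (hη : 0 < η) (hp : 1 < p)
    (hm : 0 < m) (hA : 0 < A) (hρ : 0 < ρ)
    (hcrit : 0 < 6 * σ * (p / (p - 1)) - (3 * n + 2 * σ))
    {w v : EuclideanSpace ℝ (Fin n) → ℝ} (hw : Integrable w) (hw0 : ∀ x, 0 ≤ w x)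
    (hv0 : ∀ x, 0 ≤ v x)
    (hprof : ∀ L, 1 ≤ L → ∃ φ, IsProfile σ p A ρ L w v φ)
    (hv : ∀ ε u₀ u₁ u₂ T u, IsWeakSolution σ η p ε u₀ u₁ u₂ T u → ∀ S, 0 < S → S < T →
      IntegrableOn (fun z => |u z| * v ((spaceScale σ S)⁻¹ • z.2)) (Ioo 0 S ×ˢ univ)) :
    ∃ C > 0, ∀ u₀ u₁ u₂ : EuclideanSpace ℝ (Fin n) → ℝ,
      Integrable u₀ → Integrable u₁ → Integrable u₂ → ∫ x, u₂ x = m →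
      ∃ ε₀ > 0, ∀ ε, 0 < ε → ε ≤ ε₀ → ∀ T u, IsWeakSolution σ η p ε u₀ u₁ u₂ T u →
        T ≤ C * ε ^ (-(2 * σ / (6 * σ * (p / (p - 1)) - (3 * n + 2 * σ)))) := by
  obtain ⟨B, hB, ζ, hζ⟩ := exists_isTimeCutoff hp
  have hpq : p.HolderConjugate (p / (p - 1)) := Real.HolderConjugate.conjExponent hp
  set q := p / (p - 1) with hqdef
  have hp0 : 0 < p := by linarith
  have hq0 : 0 < q := hpq.symm.pos
  have hq1 : 1 < q := hpq.symm.lt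
  have hr : 1 - 1 / p = 1 / q := by
    have : p - 1 ≠ 0 := by linarith
    rw [hqdef]
    field_simp
  set κ := 2 * σ / (6 * σ * q - (3 * n + 2 * σ)) with hκ
  have hκ0 : 0 < κ := by positivity
  set W := ∫ x, w x with hW
  have hW0 : 0 ≤ W := integral_nonneg hw0
  set K₀ := (1 + η) * B * A with hK₀
  have hK₀0 : 0 < K₀ := by positivity
  set C₂ := (K₀ * (W + 1) ^ (1 / q)) ^ q with hC₂
  have hC₂0 : 0 < C₂ := by positivity
  have he : (3 - (1 + 3 * n / (2 * σ)) * (1 / q)) * q * κ = 1 := by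
    have h1 : (3 - (1 + 3 * n / (2 * σ)) * (1 / q)) * q
        = (6 * σ * q - (3 * n + 2 * σ)) / (2 * σ) := by
      field_simp
      ring
    rw [h1, hκ, div_mul_div_cancel₀ (by positivity), div_self hcrit.ne']
  refine ⟨(4 * C₂ / m) ^ κ, by positivity, fun u₀ u₁ u₂ h₀ h₁ h₂ hmass => ?_⟩
  obtain ⟨S₀, hS₀, hdata⟩ := exists_half_le_integral_dataTerm (p := p) (B := B) hσ hη hρ hm
    h₀ h₁ h₂ hmass (A := A)
  set C := (4 * C₂ / m) ^ κ with hC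
  have hC0 : 0 < C := by positivity
  refine ⟨(S₀ / C) ^ (-(1 / κ)), by positivity, fun ε hε hε₀ T u hu => ?_⟩
  have hsmall : S₀ ≤ C * ε ^ (-κ) := by
    have h1 : ((S₀ / C) ^ (-(1 / κ))) ^ (-κ) ≤ ε ^ (-κ) :=
      Real.rpow_le_rpow_of_nonpos hε hε₀ (by linarith)
    rw [← Real.rpow_mul (by positivity), neg_mul_neg, one_div_mul_cancel hκ0.ne', Real.rpow_one,
      div_le_iff₀ hC0] at h1
    linarith
  refine le_of_forall_lt_imp_le_of_dense fun S hST => ?_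
  rcases le_total S S₀ with hSS | hSS
  · exact hSS.trans hsmall
  have hS : 0 < S := hS₀.trans_le hSS
  have hvS := hv ε u₀ u₁ u₂ T u hu S hS hST
  -- choose the radius `L` so large that the tail is at most a quarter of `ε m`
  have htail := (tail_indicator_tendsto hv0 hvS).const_mul (K₀ * S⁻¹ ^ 3)
  rw [mul_zero] at htail
  obtain ⟨L, hL, hL1⟩ := ((htail.eventually (gt_mem_nhds
    (show 0 < ε * (m / 4) by positivity))).and (eventually_ge_atTop 1)).exists
  obtain ⟨φ, hφ⟩ := hprof L hL1
  have hineq := hu.test_inequality hσ hη hp hS hST hA hB hζ hφ hw hw0 hv0 hvS MeasurableSet.univ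
    (fun z _ hz => absurd (mem_univ z) hz)
  simp only [indicator_univ] at hineq
  have hd := mul_le_mul_of_nonneg_left (hdata S hSS ζ hζ L w v φ hφ) hε.le
  set X := ∫ z in Ioo 0 T ×ˢ univ, |u z| ^ p * scaledTest σ ζ φ S z
  have hX : 0 ≤ X := integral_nonneg fun z =>
    mul_nonneg (by positivity) (scaledTest_nonneg hζ hφ.nonneg z)
  set e := 3 - (1 + 3 * n / (2 * σ)) * (1 / q) with hedef
  have hid := scale_identity (σ := σ) hS hW0 n (1 / q)
  rw [hr, mul_add, ← hK₀, ← hW] at hineq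
  have hM : K₀ * S⁻¹ ^ 3 * (X ^ (1 / p) * (S * (spaceScale σ S ^ n * W)) ^ (1 / q))
      = X ^ (1 / p) * (K₀ * W ^ (1 / q) * S ^ (-e)) := by
    rw [show K₀ * S⁻¹ ^ 3 * (X ^ (1 / p) * (S * (spaceScale σ S ^ n * W)) ^ (1 / q))
      = X ^ (1 / p) * K₀ * (S⁻¹ ^ 3 * (S * (spaceScale σ S ^ n * W)) ^ (1 / q)) by ring, hid]
    ring
  rw [hM] at hineq
  have hyoung := Real.young_inequality_of_nonneg (Real.rpow_nonneg hX (1 / p))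
    (show 0 ≤ K₀ * W ^ (1 / q) * S ^ (-e) by positivity) hpq
  rw [← Real.rpow_mul hX, one_div_mul_cancel hp0.ne', Real.rpow_one] at hyoung
  have hX' : X / p ≤ X := div_le_self hX hp.le
  have hY : (K₀ * W ^ (1 / q) * S ^ (-e)) ^ q / q ≤ C₂ * S ^ (-(e * q)) := by
    refine (div_le_self (by positivity) hq1.le).trans ?_
    rw [Real.mul_rpow (by positivity) (by positivity), ← Real.rpow_mul hS.le, neg_mul]
    refine mul_le_mul_of_nonneg_right ?_ (by positivity)
    rw [hC₂]
    gcongr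
    linarith
  have hfin : ε * (m / 4) ≤ C₂ * S ^ (-(e * q)) := by linarith
  rw [Real.rpow_neg hS.le, ← div_eq_mul_inv, le_div_iff₀ (by positivity)] at hfin
  have hSe : S ^ (e * q) ≤ 4 * C₂ / m * ε⁻¹ := by
    rw [← div_eq_mul_inv, div_div, le_div_iff₀ (by positivity)]
    linarith
  calc S = (S ^ (e * q)) ^ κ := by rw [← Real.rpow_mul hS.le, he, Real.rpow_one]
    _ ≤ (4 * C₂ / m * ε⁻¹) ^ κ := Real.rpow_le_rpow (by positivity) hSe hκ0.le
    _ = C * ε ^ (-κ) := by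
      rw [Real.mul_rpow (by positivity) (by positivity), Real.inv_rpow hε.le, Real.rpow_neg hε.le]

lemma IsWeakSolution.integrableOn_tail {n : ℕ} {σ η p ε S T : ℝ}
    {u₀ u₁ u₂ : EuclideanSpace ℝ (Fin n) → ℝ} {u : ℝ × EuclideanSpace ℝ (Fin n) → ℝ}
    (hu : IsWeakSolution σ η p ε u₀ u₁ u₂ T u) (hσ : 0 < σ) (hint : ¬ ∃ k : ℕ, σ = 3 * k)
    (hS : 0 < S) (hST : S < T) :
    IntegrableOn (fun z => |u z| * (1 + ‖(spaceScale σ S)⁻¹ • z.2‖) ^ (-((n : ℝ) + 2 * σ / 3)))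
      (Ioo 0 S ×ˢ univ) := by
  have hR := spaceScale_pos (σ := σ) hS
  set R := spaceScale σ S
  set b := (n : ℝ) + 2 * σ / 3
  have hb : 0 < b := by positivity
  have hum : AEStronglyMeasurable u (volume.restrict (Ioo 0 S ×ˢ univ)) :=
    hu.measurable.mono_measure (Measure.restrict_mono (strip_subset hST.le) le_rfl)
  have hcont : Continuous fun z : ℝ × EuclideanSpace ℝ (Fin n) => (1 + ‖R⁻¹ • z.2‖) ^ (-b) :=
    Continuous.rpow_const (by fun_prop) fun z => Or.inl (by positivity)
  refine ((hu.tail_integrable hint S hST).const_mul ((1 + R) ^ b)).mono'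
    (hum.norm.mul hcont.aestronglyMeasurable) (ae_of_all _ fun z => ?_)
  rw [norm_mul, Real.norm_eq_abs, abs_abs, Real.norm_of_nonneg (by positivity), mul_left_comm]
  refine mul_le_mul_of_nonneg_left ?_ (abs_nonneg _)
  rw [Real.rpow_neg (by positivity), Real.rpow_neg (by positivity), ← div_eq_mul_inv,
    le_div_iff₀ (by positivity), inv_mul_le_iff₀ (by positivity),
    ← Real.mul_rpow (by positivity) (by positivity)]
  refine Real.rpow_le_rpow (by positivity) ?_ hb.le
  rw [norm_smul, norm_inv, Real.norm_of_nonneg hR.le]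
  have h1 : R * (R⁻¹ * ‖z.2‖) = ‖z.2‖ := by field_simp
  have h2 : 0 ≤ R⁻¹ * ‖z.2‖ := by positivity
  nlinarith

/-! ### The critical lifespan -/

/-- A discrete version of the blow-up for `y' = c y^p`: an increasing sequence whose increments
dominate a `p`-th power has only boundedly many terms. -/
lemma length_le_of_pow_le_increment {p M d : ℝ} (hp : 1 < p) (hM : 0 < M) (hd : 0 < d)
    {A : ℕ → ℝ} {J : ℕ} (hA0 : ∀ j, 0 ≤ A j)
    (h : ∀ j < J, A j ≤ A (j + 1) ∧ d + A (j + 1) ≤ M * (A (j + 1) - A j) ^ (1 / p)) :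
    J * ((p - 1) * M ^ (-p)) ≤ d ^ (1 - p) := by
  have hp0 : 0 < p := by linarith
  have key : ∀ j ≤ J, j * ((p - 1) * M ^ (-p)) + (d + A j) ^ (1 - p) ≤ (d + A 0) ^ (1 - p) := by
    intro j
    induction j with
    | zero => intro _; simp
    | succ j ih =>
      intro hj
      obtain ⟨h1, h2⟩ := h j (by omega)
      have ih := ih (by omega)
      set a := d + A j with ha
      set b := d + A (j + 1) with hb
      have ha0 : 0 < a := by have := hA0 j; positivity
      have hb0 : 0 < b := by have := hA0 (j + 1); positivity
      have h3 : b ^ p * M ^ (-p) ≤ b - a := by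
        have h4 : b ^ p ≤ (M * (A (j + 1) - A j) ^ (1 / p)) ^ p :=
          Real.rpow_le_rpow hb0.le h2 hp0.le
        rw [Real.mul_rpow hM.le (Real.rpow_nonneg (by linarith) _),
          ← Real.rpow_mul (by linarith), one_div_mul_cancel hp0.ne', Real.rpow_one] at h4
        rw [Real.rpow_neg hM.le, ← div_eq_mul_inv, div_le_iff₀ (by positivity)]
        rw [ha, hb]
        linarith
      set x := b ^ (p - 1) * M ^ (-p) with hx
      have hbx : b * x = b ^ p * M ^ (-p) := by
        rw [hx, ← mul_assoc]
        congr 1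
        rw [mul_comm, ← Real.rpow_add_one hb0.ne']
        ring_nf
      have h5 : a ≤ b * (1 - x) := by rw [mul_sub, hbx]; linarith
      have hx1 : 0 < 1 - x := by
        by_contra hcon
        have := mul_nonpos_of_nonneg_of_nonpos hb0.le (not_lt.1 hcon)
        linarith
      have h6 : 1 + (p - 1) * x ≤ (1 - x) ^ (1 - p) := by
        rw [Real.rpow_def_of_pos hx1]
        have h7 := Real.log_le_sub_one_of_pos hx1
        have h8 := Real.add_one_le_exp (Real.log (1 - x) * (1 - p))
        nlinarith
      have h7 : b ^ (1 - p) * (1 - x) ^ (1 - p) ≤ a ^ (1 - p) := by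
        rw [← Real.mul_rpow hb0.le hx1.le]
        exact Real.rpow_le_rpow_of_nonpos ha0 h5 (by linarith)
      have h8 : b ^ (1 - p) * x = M ^ (-p) := by
        rw [hx, ← mul_assoc, ← Real.rpow_add hb0]
        simp
      have h9 : b ^ (1 - p) + (p - 1) * M ^ (-p) ≤ a ^ (1 - p) := by
        refine le_trans ?_ h7
        have := mul_le_mul_of_nonneg_left h6 (show 0 ≤ b ^ (1 - p) by positivity)
        rw [← h8]
        linarith
      push_cast
      linarith
  have h1 := key J le_rfl
  have h2 : (d + A 0) ^ (1 - p) ≤ d ^ (1 - p) :=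
    Real.rpow_le_rpow_of_nonpos hd (by linarith [hA0 0]) (by linarith)
  have h3 : 0 ≤ (d + A J) ^ (1 - p) := Real.rpow_nonneg (by linarith [hA0 J]) _
  linarith

/-- The annular region where the derivatives of the test function at scale `S` live. -/
def scaleAnnulus {n : ℕ} (σ ρ S : ℝ) : Set (ℝ × EuclideanSpace ℝ (Fin n)) :=
  {z | S⁻¹ * z.1 < 1 / 2 ∧ ‖(spaceScale σ S)⁻¹ • z.2‖ < ρ}ᶜ

lemma measurableSet_scaleAnnulus {n : ℕ} (σ ρ S : ℝ) :
    MeasurableSet (scaleAnnulus σ ρ S : Set (ℝ × EuclideanSpace ℝ (Fin n))) := by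
  have h1 : Measurable fun z : ℝ × EuclideanSpace ℝ (Fin n) => S⁻¹ * z.1 := by fun_prop
  have h2 : Measurable fun z : ℝ × EuclideanSpace ℝ (Fin n) => ‖(spaceScale σ S)⁻¹ • z.2‖ := by
    fun_prop
  exact ((measurableSet_lt h1 measurable_const).inter
    (measurableSet_lt h2 measurable_const)).compl

/-- The profile at scale `2S` is `1` on the support of the profile at scale `S`, and its annulus
lies outside that support. -/
lemma scaledTest_add_indicator_le {n : ℕ} {σ p B S : ℝ} (hS : 0 < S) {ζ : ℝ → ℝ}
    (hζ : IsTimeCutoff p B ζ) {φ : EuclideanSpace ℝ (Fin n) → ℝ} (h0 : ∀ x, 0 ≤ φ x)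
    (h1 : ∀ x, φ x ≤ 1) (hρ : ∀ x, ‖x‖ < spaceScale σ 2⁻¹ → φ x = 1)
    (hz : ∀ x, 1 ≤ ‖x‖ → φ x = 0) {z : ℝ × EuclideanSpace ℝ (Fin n)} (hz0 : 0 < z.1) {c : ℝ}
    (hc : 0 ≤ c) :
    c * scaledTest σ ζ φ S z + (scaleAnnulus σ (spaceScale σ 2⁻¹) (2 * S)).indicator
      (fun z => c * scaledTest σ ζ φ (2 * S) z) z ≤ c * scaledTest σ ζ φ (2 * S) z := by
  have hR := spaceScale_pos (σ := σ) hS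
  by_cases hmem : z ∈ scaleAnnulus σ (spaceScale σ 2⁻¹) (2 * S)
  · rw [indicator_of_mem hmem, add_le_iff_nonpos_left]
    suffices h : scaledTest σ ζ φ S z = 0 by rw [h, mul_zero]
    rw [scaleAnnulus, mem_compl_iff, mem_ofPred_eq, not_and_or, not_lt, not_lt] at hmem
    rcases hmem with h | h
    · rw [scaledTest, hζ.eq_zero_of_le hS, zero_mul]
      rw [← div_eq_inv_mul, le_div_iff₀ (by positivity)] at h
      linarith
    · have hhalf : spaceScale σ (2 * S) * spaceScale σ 2⁻¹ = spaceScale σ S := by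
        rw [spaceScale, spaceScale, spaceScale, ← Real.mul_rpow (by positivity) (by norm_num)]
        congr 1
        ring
      have hR2 := spaceScale_pos (σ := σ) (show 0 < 2 * S by positivity)
      rw [scaledTest, hz, mul_zero]
      rw [norm_smul, norm_inv, Real.norm_of_nonneg hR.le, ← div_eq_inv_mul, le_div_iff₀ hR, one_mul]
      rw [norm_smul, norm_inv, Real.norm_of_nonneg hR2.le, ← div_eq_inv_mul, le_div_iff₀ hR2] at h
      linarith
  · rw [indicator_of_notMem hmem, add_zero]
    refine mul_le_mul_of_nonneg_left ?_ hc
    rw [scaleAnnulus, mem_compl_iff, not_not] at hmem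
    have e1 : ζ ((2 * S)⁻¹ * z.1) = 1 := hζ.eq_one _ (by
      rw [abs_of_pos (by positivity)]
      exact hmem.1)
    have e2 : φ ((spaceScale σ (2 * S))⁻¹ • z.2) = 1 := hρ _ hmem.2
    rw [scaledTest, scaledTest, e1, e2, one_mul]
    exact mul_le_one₀ (hζ.le_one _) (h0 _) (h1 _)

/-- The critical lifespan bound for the local equation. -/
theorem critical_lifespan_le {n : ℕ} {k : ℕ} {σ η p m : ℝ} (hσ : 0 < σ) (hη : 0 < η) (hp : 1 < p)
    (hm : 0 < m) (hk : σ = 3 * k) (hcrit : 6 * σ * (p / (p - 1)) = 3 * n + 2 * σ) :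
    ∃ C > 0, ∀ u₀ u₁ u₂ : EuclideanSpace ℝ (Fin n) → ℝ,
      Integrable u₀ → Integrable u₁ → Integrable u₂ → ∫ x, u₂ x = m →
      ∃ ε₀ > 0, ∀ ε, 0 < ε → ε ≤ ε₀ → ∀ T u, IsWeakSolution σ η p ε u₀ u₁ u₂ T u →
        T ≤ Real.exp (C * ε ^ (-(p - 1))) := by
  obtain ⟨B, hB, ζ, hζ⟩ := exists_isTimeCutoff hp
  have hp0 : 0 < p := by linarith
  have hp1 : 0 < p - 1 := by linarith
  set ρ := spaceScale σ 2⁻¹ with hρdef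
  have hρ : 0 < ρ := spaceScale_pos (by norm_num)
  have hρ1 : ρ < 1 := Real.rpow_lt_one (by norm_num) (by norm_num) (by positivity)
  obtain ⟨φ, hφ1, hφρ, hφz, hfrac, A, hA, hprof⟩ := exists_isProfile_of_integer n hσ hk hp hρ hρ1
  have hφ := hprof 1 le_rfl
  set w : EuclideanSpace ℝ (Fin n) → ℝ := (Metric.closedBall 0 1).indicator fun _ => 1 with hwdef
  have hw : Integrable w := (integrable_indicator_iff measurableSet_closedBall).2
    (integrableOn_const (measure_closedBall_lt_top).ne)
  have hw0 : ∀ x, 0 ≤ w x := fun x => indicator_nonneg (fun _ _ => zero_le_one) x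
  set W := ∫ x, w x with hW
  have hW0 : 0 ≤ W := integral_nonneg hw0
  set r := 1 - 1 / p with hr
  have hr0 : 0 < r := by
    rw [hr, sub_pos, div_lt_one hp0]; exact hp
  set M := (1 + η) * B * A * (W + 1) ^ r with hM
  have hM0 : 0 < M := by positivity
  have he : 3 - (1 + 3 * n / (2 * σ)) * r = 0 := by
    rw [hr]
    field_simp at hcrit ⊢
    linarith
  set C₂ := (m / 2) ^ (1 - p) * ((p - 1) * M ^ (-p))⁻¹ with hC₂
  have hC₂0 : 0 < C₂ := by positivity
  have hlog2 : 0 < Real.log 2 := Real.log_pos one_lt_two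
  refine ⟨C₂ * Real.log 2 + 1, by positivity, fun u₀ u₁ u₂ h₀ h₁ h₂ hmass => ?_⟩
  obtain ⟨S₀, hS₀, hdata⟩ := exists_half_le_integral_dataTerm (p := p) (B := B) hσ hη hρ hm
    h₀ h₁ h₂ hmass (A := A)
  set l := max (Real.log (2 * S₀)) 1 with hl
  have hl0 : 0 < l := by positivity
  refine ⟨l ^ (-(1 / (p - 1))), by positivity, fun ε hε hε₀ T u hu => ?_⟩
  have hsmall : l ≤ ε ^ (-(p - 1)) := by
    have h1 : (l ^ (-(1 / (p - 1)))) ^ (-(p - 1)) ≤ ε ^ (-(p - 1)) :=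
      Real.rpow_le_rpow_of_nonpos hε hε₀ (by linarith)
    rwa [← Real.rpow_mul hl0.le, neg_mul_neg, one_div_mul_cancel hp1.ne', Real.rpow_one] at h1
  refine le_of_forall_lt_imp_le_of_dense fun S hST => ?_
  -- the dyadic number of scales between `S₀` and `S`
  obtain ⟨J, hJ, hSJ⟩ : ∃ J : ℕ, (J = 0 ∨ S₀ * 2 ^ J < T) ∧ S ≤ 2 * S₀ * 2 ^ J := by
    rcases le_total S S₀ with h | h
    · exact ⟨0, Or.inl rfl, by linarith⟩
    · obtain ⟨J, h1, h2⟩ := exists_nat_pow_near ((one_le_div hS₀).2 h) (one_lt_two (α := ℝ))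
      rw [le_div_iff₀ hS₀] at h1
      rw [div_lt_iff₀ hS₀, pow_succ] at h2
      exact ⟨J, Or.inr (by linarith), by linarith⟩
  have hcount : J * ((p - 1) * M ^ (-p)) ≤ (ε * (m / 2)) ^ (1 - p) := by
    refine length_le_of_pow_le_increment (A := fun j => ∫ z in Ioo 0 T ×ˢ univ,
      |u z| ^ p * scaledTest σ ζ φ (S₀ * 2 ^ j) z) hp hM0 (by positivity)
      (fun j => integral_nonneg fun z => mul_nonneg (by positivity)
        (scaledTest_nonneg hζ hφ.nonneg z)) fun j hj => ?_
    have hJT : S₀ * 2 ^ J < T := hJ.resolve_left (by omega)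
    have hs0 : 0 < S₀ * 2 ^ j := by positivity
    have hs2 : S₀ * 2 ^ (j + 1) = 2 * (S₀ * 2 ^ j) := by ring
    have hsT : 2 * (S₀ * 2 ^ j) < T := by
      rw [← hs2]
      refine lt_of_le_of_lt ?_ hJT
      gcongr
      · norm_num
      · omega
    have hsd : S₀ ≤ 2 * (S₀ * 2 ^ j) := by
      have : (1 : ℝ) ≤ 2 ^ j := one_le_pow₀ one_le_two
      nlinarith
    simp only [hs2]
    set s := S₀ * 2 ^ j
    have hs20 : 0 < 2 * s := by positivity
    have i1 := hu.integrableOn_rpow_mul hs0 (by linarith) hζ hφ.smooth hφ.compact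
    have i2 := hu.integrableOn_rpow_mul hs20 hsT hζ hφ.smooth hφ.compact
    have i3 : IntegrableOn (fun z => (scaleAnnulus σ ρ (2 * s)).indicator
        (fun z => |u z| ^ p * scaledTest σ ζ φ (2 * s) z) z) (Ioo 0 T ×ˢ univ) :=
      Integrable.indicator i2 (measurableSet_scaleAnnulus σ ρ (2 * s))
    have hincr : (∫ z in Ioo 0 T ×ˢ univ, |u z| ^ p * scaledTest σ ζ φ s z)
        + (∫ z in Ioo 0 T ×ˢ univ, (scaleAnnulus σ ρ (2 * s)).indicator
          (fun z => |u z| ^ p * scaledTest σ ζ φ (2 * s) z) z)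
        ≤ ∫ z in Ioo 0 T ×ˢ univ, |u z| ^ p * scaledTest σ ζ φ (2 * s) z := by
      rw [← integral_add i1 i3]
      refine setIntegral_mono_on (i1.add i3) i2 (measurableSet_strip T) fun z hz => ?_
      exact scaledTest_add_indicator_le hs0 hζ hφ.nonneg hφ1 hφρ hφz hz.1.1 (by positivity)
    have hann0 : 0 ≤ ∫ z in Ioo 0 T ×ˢ univ, (scaleAnnulus σ ρ (2 * s)).indicator
        (fun z => |u z| ^ p * scaledTest σ ζ φ (2 * s) z) z :=
      integral_nonneg fun z => indicator_nonneg (fun z _ => mul_nonneg (by positivity)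
        (scaledTest_nonneg hζ hφ.nonneg z)) z
    refine ⟨by linarith, ?_⟩
    have htest := hu.test_inequality (w := w) (v := fun _ => 0) hσ hη hp hs20 hsT hA hB hζ hφ hw hw0
      (fun _ => le_rfl) (by simp) (measurableSet_scaleAnnulus σ ρ (2 * s)) (fun z hz0 hz => by
        rw [scaleAnnulus, mem_compl_iff, not_not] at hz
        have habs : |(2 * s)⁻¹ * z.1| < 1 / 2 := by
          rw [abs_of_pos (by positivity)]
          exact hz.1
        obtain ⟨f1, f2, f3⟩ := hfrac _ hz.2
        rw [adjointOp_scaledTest hσ hs20 hζ, f1, f2, f3, hζ.deriv_eq_zero _ habs 3 (by norm_num)]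
        simp)
    simp only [mul_zero, indicator_zero, integral_zero, add_zero] at htest
    have hid := scale_identity (σ := σ) hs20 hW0 n r
    rw [he, neg_zero, Real.rpow_zero, mul_one] at hid
    have hd := mul_le_mul_of_nonneg_left (hdata (2 * s) hsd ζ hζ 1 w _ φ hφ) hε.le
    set Y := ∫ z in Ioo 0 T ×ˢ univ, (scaleAnnulus σ ρ (2 * s)).indicator
        (fun z => |u z| ^ p * scaledTest σ ζ φ (2 * s) z) z
    calc ε * (m / 2) + ∫ z in Ioo 0 T ×ˢ univ, |u z| ^ p * scaledTest σ ζ φ (2 * s) z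
        ≤ (1 + η) * B * A * (2 * s)⁻¹ ^ 3 * (Y ^ (1 / p) *
          (2 * s * (spaceScale σ (2 * s) ^ n * W)) ^ r) := by linarith
      _ = (1 + η) * B * A * Y ^ (1 / p) *
          ((2 * s)⁻¹ ^ 3 * (2 * s * (spaceScale σ (2 * s) ^ n * W)) ^ r) := by ring
      _ = (1 + η) * B * A * Y ^ (1 / p) * W ^ r := by rw [hid]
      _ ≤ (1 + η) * B * A * Y ^ (1 / p) * (W + 1) ^ r := by
          gcongr
          linarith
      _ = M * Y ^ (1 / p) := by rw [hM]; ring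
      _ ≤ _ := by
          gcongr
          linarith
  have hJle : (J : ℝ) ≤ C₂ * ε ^ (-(p - 1)) := by
    have hpos : 0 < (p - 1) * M ^ (-p) := by positivity
    rw [← le_div_iff₀ hpos, div_eq_mul_inv, Real.mul_rpow hε.le (by positivity)] at hcount
    rw [hC₂, neg_sub]
    linarith
  have h2J : (2 : ℝ) ^ J = Real.exp (J * Real.log 2) := by
    rw [mul_comm, Real.exp_mul, Real.exp_log two_pos, Real.rpow_natCast]
  have h2S : 2 * S₀ ≤ Real.exp l := by
    rw [← Real.log_le_iff_le_exp (by positivity)]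
    exact le_max_left _ _
  calc S ≤ 2 * S₀ * 2 ^ J := hSJ
    _ ≤ Real.exp l * Real.exp (J * Real.log 2) := by rw [h2J]; gcongr
    _ = Real.exp (l + J * Real.log 2) := (Real.exp_add _ _).symm
    _ ≤ _ := by
      refine Real.exp_le_exp.2 ?_
      have := mul_le_mul_of_nonneg_right hJle hlog2.le
      linarith

/-! ### The critical exponent and the lifespan -/

lemma pos_of_lt_pCrit {n : ℕ} {σ p : ℝ} (hσ : 0 < σ) (hp : 1 < p)
    (h : ENNReal.ofReal p < pCrit n σ) : 0 < 6 * σ * (p / (p - 1)) - (3 * n + 2 * σ) := by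
  have hp1 : 0 < p - 1 := by linarith
  rw [sub_pos, mul_div_assoc', lt_div_iff₀ hp1]
  rcases le_or_gt (3 * (n : ℝ) - 4 * σ) 0 with hn | hn
  · nlinarith
  · rw [pCrit, ← ENNReal.ofReal_div_of_pos hn, ← ENNReal.ofReal_one,
      ← ENNReal.ofReal_add zero_le_one (by positivity), ENNReal.ofReal_lt_ofReal_iff (by positivity),
      ← sub_lt_iff_lt_add', lt_div_iff₀ hn] at h
    linarith

lemma eq_of_eq_pCrit {n : ℕ} {σ p : ℝ} (hσ : 0 < σ) (hp : 1 < p)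
    (h : ENNReal.ofReal p = pCrit n σ) : 6 * σ * (p / (p - 1)) = 3 * n + 2 * σ := by
  have hp1 : 0 < p - 1 := by linarith
  rw [mul_div_assoc', div_eq_iff hp1.ne']
  rcases le_or_gt (3 * (n : ℝ) - 4 * σ) 0 with hn | hn
  · have h0 : ENNReal.ofReal (6 * σ) ≠ 0 := by simpa using hσ
    rw [pCrit, ENNReal.ofReal_of_nonpos hn, ENNReal.div_zero h0, add_top] at h
    exact absurd h ENNReal.ofReal_ne_top
  · rw [pCrit, ← ENNReal.ofReal_div_of_pos hn, ← ENNReal.ofReal_one,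
      ← ENNReal.ofReal_add zero_le_one (by positivity),
      ENNReal.ofReal_eq_ofReal_iff (by linarith) (by positivity), ← sub_eq_iff_eq_add',
      eq_div_iff hn.ne'] at h
    linarith

lemma weakLifespan_le {n : ℕ} {σ η p ε b : ℝ} {u₀ u₁ u₂ : EuclideanSpace ℝ (Fin n) → ℝ}
    (h : ∀ T u, IsWeakSolution σ η p ε u₀ u₁ u₂ T u → T ≤ b) :
    weakLifespan σ η p ε u₀ u₁ u₂ ≤ ENNReal.ofReal b := by
  refine sSup_le ?_
  rintro τ ⟨T, rfl, u, hu, -⟩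
  exact ENNReal.ofReal_le_ofReal (h T u hu)

theorem mainTheorem4 (n : ℕ) (hn : 1 ≤ n) (σ η p m : ℝ) (hσ : 0 < σ) (hη : 1 < η) (hp : 1 < p)
    (hm : 0 < m) :
    (ENNReal.ofReal p < pCrit n σ →
      ∃ C > 0, ∀ u₀ u₁ u₂ : EuclideanSpace ℝ (Fin n) → ℝ,
        Integrable u₀ → Integrable u₁ → Integrable u₂ → ∫ x, u₂ x = m →
        ∃ ε₀ > 0, ∀ ε, 0 < ε → ε ≤ ε₀ →
          (∀ T u, IsWeakSolution σ η p ε u₀ u₁ u₂ T u →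
            T ≤ C * ε ^ (-(2 * σ / (6 * σ * (p / (p - 1)) - (3 * n + 2 * σ))))) ∧
          weakLifespan σ η p ε u₀ u₁ u₂ ≤
            ENNReal.ofReal
              (C * ε ^ (-(2 * σ / (6 * σ * (p / (p - 1)) - (3 * n + 2 * σ)))))) ∧
    (ENNReal.ofReal p = pCrit n σ → (∃ k : ℕ, σ = 3 * k) →
      ∃ C > 0, ∀ u₀ u₁ u₂ : EuclideanSpace ℝ (Fin n) → ℝ,
        ContDiff ℝ ∞ u₀ → HasCompactSupport u₀ →
        ContDiff ℝ ∞ u₁ → HasCompactSupport u₁ →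
        ContDiff ℝ ∞ u₂ → HasCompactSupport u₂ → ∫ x, u₂ x = m →
        ∃ ε₀ > 0, ∀ ε, 0 < ε → ε ≤ ε₀ →
          (∀ T u, IsWeakSolution σ η p ε u₀ u₁ u₂ T u →
            T ≤ Real.exp (C * ε ^ (-(p - 1)))) ∧
          weakLifespan σ η p ε u₀ u₁ u₂ ≤
            ENNReal.ofReal (Real.exp (C * ε ^ (-(p - 1))))) := by
  have hη0 : 0 < η := by linarith
  constructor
  · intro h
    have hcrit := pos_of_lt_pCrit hσ hp h
    have key : ∃ C > 0, ∀ u₀ u₁ u₂ : EuclideanSpace ℝ (Fin n) → ℝ,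
        Integrable u₀ → Integrable u₁ → Integrable u₂ → ∫ x, u₂ x = m →
        ∃ ε₀ > 0, ∀ ε, 0 < ε → ε ≤ ε₀ → ∀ T u, IsWeakSolution σ η p ε u₀ u₁ u₂ T u →
          T ≤ C * ε ^ (-(2 * σ / (6 * σ * (p / (p - 1)) - (3 * n + 2 * σ)))) := by
      by_cases hint : ∃ k : ℕ, σ = 3 * k
      · obtain ⟨k, hk⟩ := hint
        obtain ⟨φ, -, -, -, -, A, hA, hprof⟩ := exists_isProfile_of_integer n hσ hk hp
          (ρ := 1 / 2) (by norm_num) (by norm_num)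
        exact lifespan_le_of_profiles hσ hη0 hp hm hA (by norm_num) hcrit
          ((integrable_indicator_iff measurableSet_closedBall).2
            (integrableOn_const (measure_closedBall_lt_top).ne))
          (fun x => indicator_nonneg (fun _ _ => zero_le_one) x) (fun _ => le_rfl)
          (fun L hL => ⟨φ, hprof L hL⟩) (fun _ _ _ _ _ _ _ _ _ _ => by simp)
      · obtain ⟨A, hA, hprof⟩ := exists_nonlocal_profiles n hσ hp
          (ρ := 1 / 2) (by norm_num) (by norm_num)
        refine lifespan_le_of_profiles hσ hη0 hp hm hA (by norm_num) hcrit ?_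
          (fun x => by positivity) (fun x => by positivity) (fun L _ => hprof L)
          (fun _ _ _ _ _ _ hu S hS hST => hu.integrableOn_tail hσ hint hS hST)
        exact integrable_one_add_norm (by
          rw [finrank_euclideanSpace, Fintype.card_fin]
          linarith)
    obtain ⟨C, hC, hkey⟩ := key
    refine ⟨C, hC, fun u₀ u₁ u₂ h₀ h₁ h₂ hmass => ?_⟩
    obtain ⟨ε₀, hε₀, hT⟩ := hkey u₀ u₁ u₂ h₀ h₁ h₂ hmass
    exact ⟨ε₀, hε₀, fun ε hε hle => ⟨hT ε hε hle, weakLifespan_le (hT ε hε hle)⟩⟩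
  · rintro h ⟨k, hk⟩
    obtain ⟨C, hC, hkey⟩ := critical_lifespan_le hσ hη0 hp hm hk (eq_of_eq_pCrit hσ hp h)
    refine ⟨C, hC, fun u₀ u₁ u₂ s₀ c₀ s₁ c₁ s₂ c₂ hmass => ?_⟩
    obtain ⟨ε₀, hε₀, hT⟩ := hkey u₀ u₁ u₂ (s₀.continuous.integrable_of_hasCompactSupport c₀)
      (s₁.continuous.integrable_of_hasCompactSupport c₁)
      (s₂.continuous.integrable_of_hasCompactSupport c₂) hmass
    exact ⟨ε₀, hε₀, fun ε hε hle => ⟨hT ε hε hle, weakLifespan_le (hT ε hε hle)⟩⟩
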